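/- Let $\ell\in\mathbb N$, $\alpha\in[0,1)$ and $\tilde C>0$ be constants. Then there is a constant $c_1>0$, depending only on $\ell,\alpha,\tilde C$, such that the following holds for every function $p=p(n)\in\mathbb N$ with $p=o(\log\log n)$. First, $c_1^{p}\,n^{1-(1-\alpha)^{p}/4}=o(n)$. Second, let $n$ be sufficiently large (depending on $\ell,\alpha,\tilde C$ and the function $p$). Let $\rho_0$ be any pure product state of $n$ qubits, and let $H^{(1)},\dots,H^{(p)}$ be $\ell$-local commuting Hamiltonians on $n$ qubits: each $H^{(i)}=\sum_j H^{(i)}_j$ is a finite sum of pairwise commuting Hermitian terms, each acting non-trivially on at most $\ell$ qubits (different $H^{(i)}$ need not commute, and a qubit may take part in arbitrarily many terms). For $S\subseteq\{1,\dots,n\}$ let $H^{(i)}_S$ be the sum of those terms of $H^{(i)}$ that act non-trivially on at least one qubit in $S$, and suppose that in operator norm $$\|H^{(i)}_S\|\le \tilde C\,n^{\alpha}|S|^{1-\alpha}\qquad\text{for all } i \text{ and all } S\subseteq\{1,\dots,n\}.$$ Put $U_i=e^{-\mathrm{i}H^{(i)}}$ and $\rho_p=(U_p\cdots U_1)\,\rho_0\,(U_1^\dagger\cdots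 U_p^\dagger)$, let $W_{\rho_p}$ be the Hamming weight of the outcome of measuring $\rho_p$ in the computational basis, and let $m$ be any median of $W_{\rho_p}$. Then $$\Pr\left[\,|W_{\rho_p}-m|>c_1^{p}\,n^{1-(1-\alpha)^{p}/4}\,\right]\le 128\,e^{-\sqrt2\,n^{1/8}}.$$ -/

import Mathlib

open Filter Asymptotics

namespace DenseEvolution

/-- Computational basis strings `x ∈ {0,1}^n`. -/
abbrev Bits (n : ℕ) : Type := Fin n → Fin 2

/-- Linear operators on the `n`-qubit space `(ℂ²)^{⊗ n}`, written as matrices in the computational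
basis. -/
abbrev Op (n : ℕ) : Type := Matrix (Bits n) (Bits n) ℂ

/-- `A` acts trivially on qubit `i`, i.e. `A = 1_i ⊗ A'` for some operator `A'` on the other
qubits: `⟨x|A|y⟩` vanishes unless `x i = y i`, and then it does not depend on this common value. -/
def ActsTriviallyOn {n : ℕ} (A : Op n) (i : Fin n) : Prop :=
  (∀ x y : Bits n, x i ≠ y i → A x y = 0) ∧
    ∀ (x y : Bits n) (b : Fin 2), x i = y i →
      A (Function.update x i b) (Function.update y i b) = A x y

open Classical in
/-- The set of qubits on which `A` acts non-trivially. -/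
noncomputable def support {n : ℕ} (A : Op n) : Finset (Fin n) :=
  Finset.univ.filter fun i => ¬ ActsTriviallyOn A i

/-- An `ℓ`-local commuting Hamiltonian on `n` qubits, given with its local terms: finitely many
pairwise commuting Hermitian operators, each acting non-trivially on at most `ℓ` qubits. A qubit may
take part in arbitrarily many terms. -/
structure CommutingHamiltonian (n ℓ : ℕ) where
  /-- the number of local terms -/
  numTerms : ℕ
  /-- the local terms -/
  term : Fin numTerms → Op n
  isHermitian_term : ∀ j, (term j).IsHermitian
  card_support_term_le : ∀ j, (support (term j)).card ≤ ℓ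
  commute_term : ∀ j k, Commute (term j) (term k)

namespace CommutingHamiltonian

variable {n ℓ : ℕ}

/-- The Hamiltonian itself, the sum of its local terms. -/
noncomputable def total (H : CommutingHamiltonian n ℓ) : Op n := ∑ j, H.term j

open Classical in
/-- The subset Hamiltonian `H_S`: the sum of those local terms that act non-trivially on at least
one qubit in `S`. -/
noncomputable def subset (H : CommutingHamiltonian n ℓ) (S : Finset (Fin n)) : Op n :=
  ∑ j with (support (H.term j) ∩ S).Nonempty, H.term j

/-- The unitary `exp(-i H)`. -/
noncomputable def unitary (H : CommutingHamiltonian n ℓ) : Op n :=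
  NormedSpace.exp (-(Complex.I • H.total))

open scoped Matrix.Norms.L2Operator in
/-- The norm constraint `‖H_S‖ ≤ C n^α |S|^(1-α)` for all sets `S` of qubits, where `‖·‖` is the
operator norm coming from the Euclidean norm. -/
def SubsetNormBound (H : CommutingHamiltonian n ℓ) (α C : ℝ) : Prop :=
  ∀ S : Finset (Fin n), ‖H.subset S‖ ≤ C * (n : ℝ) ^ α * (S.card : ℝ) ^ (1 - α)

end CommutingHamiltonian

/-- `ρ = |ψ⟩⟨ψ|` for a product `ψ = ψ_1 ⊗ ⋯ ⊗ ψ_n` of single-qubit unit vectors. -/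
def IsPureProductState {n : ℕ} (ρ : Op n) : Prop :=
  ∃ ψ : Fin n → EuclideanSpace ℂ (Fin 2), (∀ i, ‖ψ i‖ = 1) ∧
    ∀ x y : Bits n, ρ x y = (∏ i, ψ i (x i)) * star (∏ i, ψ i (y i))

/-- The output `ρ_p = (U_p ⋯ U_1) ρ_0 (U_1† ⋯ U_p†)` of a level-`p` dense Hamiltonian evolution,
where `U_i = exp(-i H_i)`. -/
noncomputable def outputState {n ℓ : ℕ} (ρ₀ : Op n) :
    (p : ℕ) → (Fin p → CommutingHamiltonian n ℓ) → Op n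
  | 0, _ => ρ₀
  | p + 1, H =>
      (H (Fin.last p)).unitary * outputState ρ₀ p (fun i => H i.castSucc) *
        (H (Fin.last p)).unitary.conjTranspose

/-- `Pr[W_ρ = w]`, where `W_ρ` is the Hamming weight of the outcome of measuring `ρ` in the
computational basis: the sum of `⟨x|ρ|x⟩` over the strings `x` of Hamming weight `w`. -/
noncomputable def weightProb {n : ℕ} (ρ : Op n) (w : ℕ) : ℝ :=
  ∑ x : Bits n with hammingNorm x = w, (ρ x x).re

open Classical in
/-- `Pr[W_ρ ∈ E]`; note that `W_ρ` takes values in `{0, …, n}`. -/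
noncomputable def weightPr {n : ℕ} (ρ : Op n) (E : Set ℝ) : ℝ :=
  ∑ w ∈ (Finset.range (n + 1)).filter (fun w : ℕ => (w : ℝ) ∈ E), weightProb ρ w

/-- `m` is a median of `W_ρ`. -/
def IsWeightMedian {n : ℕ} (ρ : Op n) (m : ℝ) : Prop :=
  1 / 2 ≤ weightPr ρ {w | w ≤ m} ∧ 1 / 2 ≤ weightPr ρ {w | m ≤ w}

/-- The deviation `c^p n^(1 - (1-α)^p / 4)`. -/
noncomputable def deviation (c α : ℝ) (n p : ℕ) : ℝ :=
  c ^ p * (n : ℝ) ^ (1 - (1 - α) ^ p / 4)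

end DenseEvolution

/-!
A pure state `ρ = |φ⟩⟨φ|` that is within `ε`, in operator norm, of a `k`-local operator `K` cannot
have much weight on two sets of strings at Hamming distance more than `k`, because `K` has no matrix
entries between them (`sum_mul_sum_le_of_kLocal_approx`). Taking for one set the strings whose weight
is on one side of the median shows that the Hamming weight deviates from its median by more than `k`
with probability at most `4 ε ^ 2` (`weightPr_deviation_le`). It remains to approximate the output
state by a local operator.

*Initial state.* A product state is the projector onto the kernel of a number operator with spectrum
in `{0, …, n}` which is a sum of single-qubit terms. A rescaled Chebyshev polynomial of degree `d` in
this operator is a `d`-local approximation with error `2 exp (-d / √n)`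
(`IsPureProductState.exists_kLocal_approx`). Degree of order `n ^ (5 / 8)` gives error
`exp (-2 n ^ (1 / 8))`.

*One layer.* If `A` acts on a set `S` of at most `k` qubits, the terms of `H` that do not touch `S`
cancel in `U A U†`, so `U` can be replaced by `exp (-i H_S)`, and this by its Taylor polynomial of
degree `d` slightly larger than `e ‖H_S‖`. Each power of `H_S` adds locality `ℓ`. A general `k`-local
operator is first decomposed, by inclusion-exclusion over restrictions to sets of qubits, into parts
on at most `k` qubits with total norm at most `e ^ 2 n ^ k` times its own
(`exists_kLocal_approx`); compensating for this factor costs a further `k log n` in the degree. In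
total a layer turns locality `κ` into at most `B log n · n ^ α κ ^ (1 - α)`
(`CommutingHamiltonian.exists_kLocal_approx`, `exists_degree`).

*Iteration.* From `n ^ (5 / 8)`, after `p` layers the locality is at most
`(B log n) ^ (p + 1) n ^ (1 - (1 - α) ^ p * (3 / 8))` (`exists_kLocal_approx_outputState`). For
`p = o(log log n)` the power of `B log n` is `exp (O((log log n) ^ 2))`, whereas
`n ^ ((1 - α) ^ p / 8)` is at least `exp (√(log n) / 8)`; so the gap between the exponents `3 / 8` and
`1 / 4` absorbs it (`pow_le_rpow_of_loglog`), and the deviation bound holds with `c₁ = 1`, the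
constants `ℓ` and `C` entering only through how large `n` has to be.
-/

namespace DenseEvolution

/-! ### Operators on a set of qubits -/

section Local

variable {n : ℕ}

/-- Relabelling the values of the `i`-th bit by a permutation of `Fin 2`. -/
def relabelBit (i : Fin n) (σ : Equiv.Perm (Fin 2)) : Equiv.Perm (Bits n) where
  toFun z := Function.update z i (σ (z i))
  invFun z := Function.update z i (σ.symm (z i))
  left_inv z := by simp
  right_inv z := by simp

lemma relabelBit_apply (i : Fin n) (σ : Equiv.Perm (Fin 2)) (z : Bits n) :
    relabelBit i σ z = Function.update z i (σ (z i)) := rfl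

/-- Acting trivially on `i` is invariance of all matrix entries under changing the `i`-th bit, even
when the two indices differ at `i`, as both entries then vanish. -/
lemma ActsTriviallyOn.apply_relabelBit {A : Op n} {i : Fin n} (hA : ActsTriviallyOn A i)
    (σ : Equiv.Perm (Fin 2)) (x y : Bits n) :
    A (relabelBit i σ x) (relabelBit i σ y) = A x y := by
  by_cases h : x i = y i
  · rw [relabelBit_apply, relabelBit_apply, ← h, hA.2 x y _ h]
  · rw [hA.1 x y h, hA.1]
    simpa [relabelBit_apply] using h

lemma ActsTriviallyOn.mul {A B : Op n} {i : Fin n} (hA : ActsTriviallyOn A i)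
    (hB : ActsTriviallyOn B i) : ActsTriviallyOn (A * B) i := by
  refine ⟨fun x y h => ?_, fun x y b h => ?_⟩
  · rw [Matrix.mul_apply]
    refine Finset.sum_eq_zero fun z _ => ?_
    by_cases hz : x i = z i
    · rw [hB.1 z y (hz ▸ h), mul_zero]
    · rw [hA.1 x z hz, zero_mul]
  · have hx : Function.update x i b = relabelBit i (Equiv.swap (x i) b) x := by
      simp [relabelBit_apply]
    have hy : Function.update y i b = relabelBit i (Equiv.swap (x i) b) y := by
      simp [relabelBit_apply, h]
    rw [hx, hy, Matrix.mul_apply, Matrix.mul_apply,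
      ← Equiv.sum_comp (relabelBit i (Equiv.swap (x i) b))]
    simp_rw [hA.apply_relabelBit, hB.apply_relabelBit]

lemma actsTriviallyOn_algebraMap (c : ℂ) (i : Fin n) :
    ActsTriviallyOn (algebraMap ℂ (Op n) c) i := by
  refine ⟨fun x y h => ?_, fun x y b h => ?_⟩
  · rw [Matrix.algebraMap_matrix_apply, if_neg fun e => h (congrFun e i)]
  · have : Function.update x i b = Function.update y i b ↔ x = y := by
      refine ⟨fun e => funext fun j => ?_, fun e => e ▸ rfl⟩
      rcases eq_or_ne j i with rfl | hj
      · exact h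
      · simpa [hj] using congrFun e j
    simp [Matrix.algebraMap_matrix_apply, this]

/-- The operators acting non-trivially only on qubits in `S`. -/
def localAlgebra (S : Finset (Fin n)) : StarSubalgebra ℂ (Op n) where
  carrier := {A | ∀ i ∉ S, ActsTriviallyOn A i}
  mul_mem' hA hB i hi := (hA i hi).mul (hB i hi)
  add_mem' hA hB i hi := by
    refine ⟨fun x y h => ?_, fun x y b h => ?_⟩
    · simp [(hA i hi).1 x y h, (hB i hi).1 x y h]
    · simp [(hA i hi).2 x y b h, (hB i hi).2 x y b h]
  algebraMap_mem' c i _ := actsTriviallyOn_algebraMap c i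
  star_mem' hA i hi := by
    refine ⟨fun x y h => ?_, fun x y b h => ?_⟩
    · simp [Matrix.star_apply, (hA i hi).1 y x (Ne.symm h)]
    · simp [Matrix.star_apply, (hA i hi).2 y x b h.symm]

lemma mem_localAlgebra {S : Finset (Fin n)} {A : Op n} :
    A ∈ localAlgebra S ↔ ∀ i ∉ S, ActsTriviallyOn A i := Iff.rfl

lemma mem_localAlgebra_iff_support_subset {S : Finset (Fin n)} {A : Op n} :
    A ∈ localAlgebra S ↔ support A ⊆ S := by
  simp only [mem_localAlgebra, support, Finset.subset_iff, Finset.mem_filter, Finset.mem_univ,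
    true_and]
  exact forall_congr' fun i => not_imp_comm

lemma mem_localAlgebra_support (A : Op n) : A ∈ localAlgebra (support A) :=
  mem_localAlgebra_iff_support_subset.2 subset_rfl

lemma localAlgebra_mono {S T : Finset (Fin n)} (h : S ⊆ T) : localAlgebra S ≤ localAlgebra T :=
  fun _ hA i hi => hA i fun hS => hi (h hS)

lemma apply_eq_zero_of_ne {S : Finset (Fin n)} {A : Op n} (hA : A ∈ localAlgebra S)
    {x y : Bits n} {i : Fin n} (hi : i ∉ S) (h : x i ≠ y i) : A x y = 0 :=
  (hA i hi).1 x y h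

/-- Bits outside of `S` on which the two indices agree can be replaced simultaneously. -/
lemma apply_piecewise {S T : Finset (Fin n)} {A : Op n} (hA : A ∈ localAlgebra S)
    (hT : Disjoint T S) {x y : Bits n} (h : ∀ i ∈ T, x i = y i) (w : Bits n) :
    A (T.piecewise w x) (T.piecewise w y) = A x y := by
  induction T using Finset.induction_on with
  | empty => simp
  | insert a T ha ih =>
    rw [Finset.disjoint_insert_left] at hT
    rw [Finset.piecewise_insert, Finset.piecewise_insert, (hA a hT.1).2 _ _ _ ?_,
      ih hT.2 fun i hi => h i (Finset.mem_insert_of_mem hi)]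
    simpa [ha] using h a (Finset.mem_insert_self a T)

/-- Operators on disjoint sets of qubits commute. -/
lemma commute_of_disjoint {S T : Finset (Fin n)} (h : Disjoint S T) {A B : Op n}
    (hA : A ∈ localAlgebra S) (hB : B ∈ localAlgebra T) : Commute A B := by
  ext x y
  -- Only `z` equal to `x` off `S` and to `y` off `T` contribute.
  have key : ∀ {S T : Finset (Fin n)}, Disjoint S T → ∀ {A B : Op n}, A ∈ localAlgebra S →
      B ∈ localAlgebra T → ∀ x y : Bits n, (A * B) x y =
        A x (S.piecewise y x) * B (S.piecewise y x) y := by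
    intro S T h A B hA hB x y
    rw [Matrix.mul_apply]
    refine Finset.sum_eq_single _ (fun z _ hz => ?_) (by simp)
    obtain ⟨i, hi⟩ := Function.ne_iff.1 hz
    by_cases hiS : i ∈ S
    · rw [Finset.piecewise_eq_of_mem _ _ _ hiS] at hi
      rw [apply_eq_zero_of_ne hB (Finset.disjoint_left.1 h hiS) hi, mul_zero]
    · rw [Finset.piecewise_eq_of_notMem _ _ _ hiS] at hi
      rw [apply_eq_zero_of_ne hA hiS hi.symm, zero_mul]
  by_cases hxy : ∃ i, i ∉ S ∧ i ∉ T ∧ x i ≠ y i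
  · obtain ⟨i, hS, hT, hi⟩ := hxy
    have h1 : A * B ∈ localAlgebra (S ∪ T) := mul_mem
      (localAlgebra_mono Finset.subset_union_left hA)
      (localAlgebra_mono Finset.subset_union_right hB)
    have h2 : B * A ∈ localAlgebra (S ∪ T) := mul_mem
      (localAlgebra_mono Finset.subset_union_right hB)
      (localAlgebra_mono Finset.subset_union_left hA)
    have hST : i ∉ S ∪ T := by simp [hS, hT]
    rw [apply_eq_zero_of_ne h1 hST hi, apply_eq_zero_of_ne h2 hST hi]
  · push Not at hxy
    rw [key h hA hB, key h.symm hB hA, mul_comm]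
    have e1 : A (T.piecewise y x) y = A x (S.piecewise y x) := by
      rw [← apply_piecewise hA h.symm (x := x) (y := S.piecewise y x) (w := y)
        fun i hi => by rw [Finset.piecewise_eq_of_notMem _ _ _ (Finset.disjoint_right.1 h hi)]]
      congr 1
      ext i
      by_cases hT : i ∈ T <;> by_cases hS : i ∈ S <;> simp [hT, hS]
      rw [hxy i hS hT]
    have e2 : B x (T.piecewise y x) = B (S.piecewise y x) y := by
      rw [← apply_piecewise hB h (x := x) (y := T.piecewise y x) (w := y)
        fun i hi => by rw [Finset.piecewise_eq_of_notMem _ _ _ (Finset.disjoint_left.1 h hi)]]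
      congr 1
      ext i
      by_cases hT : i ∈ T <;> by_cases hS : i ∈ S <;> simp [hT, hS]
      rw [hxy i hS hT]
    rw [e1, e2, mul_comm]

/-- The `k`-local operators: linear combinations of operators that act non-trivially on at most `k`
qubits each. -/
def kLocal (n k : ℕ) : Submodule ℂ (Op n) := Submodule.span ℂ {A | (support A).card ≤ k}

lemma mem_kLocal_of_mem_localAlgebra {S : Finset (Fin n)} {k : ℕ} (hS : S.card ≤ k) {A : Op n}
    (hA : A ∈ localAlgebra S) : A ∈ kLocal n k :=
  Submodule.subset_span
    ((Finset.card_le_card (mem_localAlgebra_iff_support_subset.1 hA)).trans hS)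

/-- To prove a linear property of `k`-local operators, consider operators on at most `k` qubits. -/
lemma kLocal_le {k : ℕ} {M : Submodule ℂ (Op n)}
    (h : ∀ S : Finset (Fin n), S.card ≤ k → ∀ A ∈ localAlgebra S, A ∈ M) : kLocal n k ≤ M :=
  Submodule.span_le.2 fun A hA => h _ hA A (mem_localAlgebra_support A)

lemma kLocal_mono {k l : ℕ} (h : k ≤ l) : kLocal n k ≤ kLocal n l :=
  kLocal_le fun _ hS _ hA => mem_kLocal_of_mem_localAlgebra (hS.trans h) hA

lemma one_mem_kLocal (k : ℕ) : (1 : Op n) ∈ kLocal n k :=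
  mem_kLocal_of_mem_localAlgebra (S := ∅) (by simp) (one_mem _)

lemma mul_mem_kLocal {k l : ℕ} {A B : Op n} (hA : A ∈ kLocal n k) (hB : B ∈ kLocal n l) :
    A * B ∈ kLocal n (k + l) := by
  refine kLocal_le (M := (kLocal n (k + l)).comap (LinearMap.mulRight ℂ B))
    (fun S hS A hA => ?_) hA
  refine kLocal_le (M := (kLocal n (k + l)).comap (LinearMap.mulLeft ℂ A))
    (fun T hT B hB => ?_) hB
  exact mem_kLocal_of_mem_localAlgebra
    ((Finset.card_union_le S T).trans (add_le_add hS hT))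
    (mul_mem (localAlgebra_mono Finset.subset_union_left hA)
      (localAlgebra_mono Finset.subset_union_right hB))

lemma pow_mem_kLocal {k : ℕ} {A : Op n} (hA : A ∈ kLocal n k) (j : ℕ) :
    A ^ j ∈ kLocal n (j * k) := by
  induction j with
  | zero => simpa using one_mem_kLocal 0
  | succ j ih => rw [pow_succ, Nat.succ_mul]; exact mul_mem_kLocal ih hA

/-- A polynomial of degree at most `d` in a `k`-local operator is `d k`-local. -/
lemma sum_smul_pow_mem_kLocal {k : ℕ} {A : Op n} (hA : A ∈ kLocal n k) (d : ℕ) (c : ℕ → ℂ) :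
    ∑ j ∈ Finset.range (d + 1), c j • A ^ j ∈ kLocal n (d * k) :=
  Submodule.sum_mem _ fun j hj => Submodule.smul_mem _ _ <|
    kLocal_mono (Nat.mul_le_mul_right k (Finset.mem_range_succ_iff.1 hj)) (pow_mem_kLocal hA j)

lemma star_mem_kLocal {k : ℕ} {A : Op n} (hA : A ∈ kLocal n k) : star A ∈ kLocal n k := by
  induction hA using Submodule.span_induction with
  | mem A hA =>
    exact mem_kLocal_of_mem_localAlgebra hA (star_mem (mem_localAlgebra_support A))
  | zero => simp
  | add A B _ _ hA hB => rw [star_add]; exact add_mem hA hB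
  | smul c A _ hA => rw [star_smul]; exact Submodule.smul_mem _ _ hA

/-- A `k`-local operator has no matrix entries between strings at distance more than `k`. -/
lemma apply_eq_zero_of_lt_hammingDist {k : ℕ} {A : Op n} (hA : A ∈ kLocal n k) {x y : Bits n}
    (h : k < hammingDist x y) : A x y = 0 := by
  refine kLocal_le (M := LinearMap.ker (Matrix.entryLinearMap ℂ ℂ x y)) (fun S hS A hA => ?_) hA
  obtain ⟨i, hi, hiS⟩ := Finset.exists_mem_notMem_of_card_lt_card (hS.trans_lt h)
  exact apply_eq_zero_of_ne hA hiS (Finset.mem_filter.1 hi).2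

end Local

/-! ### Decomposition of local operators with controlled norms -/

section Decomposition

open scoped Matrix.Norms.L2Operator Kronecker

lemma l2_opNorm_one_le {ι : Type*} [Fintype ι] [DecidableEq ι] : ‖(1 : Matrix ι ι ℂ)‖ ≤ 1 := by
  rw [← Matrix.diagonal_one, Matrix.l2_opNorm_diagonal, pi_norm_le_iff_of_nonneg zero_le_one]
  simp

/-- A principal submatrix is the compression by an isometry. -/
lemma l2_opNorm_submatrix_le {ι κ : Type*} [Fintype ι] [DecidableEq ι] [Fintype κ] [DecidableEq κ]
    (A : Matrix ι ι ℂ) {f : κ → ι} (hf : Function.Injective f) : ‖A.submatrix f f‖ ≤ ‖A‖ := by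
  set J : Matrix κ ι ℂ := (1 : Matrix ι ι ℂ).submatrix f id with hJ
  have hA : A.submatrix f f = J * A * J.conjTranspose := by
    ext a b
    simp [hJ, Matrix.mul_apply, Matrix.one_apply]
  have hJJ : J * J.conjTranspose = 1 := by
    ext a b
    simp [hJ, Matrix.mul_apply, Matrix.one_apply, hf.eq_iff]
  have h1 : ‖J.conjTranspose‖ ≤ 1 := by
    have := Matrix.l2_opNorm_conjTranspose_mul_self J.conjTranspose
    rw [Matrix.conjTranspose_conjTranspose, hJJ] at this
    have h2 := l2_opNorm_one_le (ι := κ)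
    nlinarith [norm_nonneg J.conjTranspose]
  have h2 : ‖J‖ ≤ 1 := by rwa [← Matrix.l2_opNorm_conjTranspose]
  calc ‖A.submatrix f f‖ ≤ ‖J‖ * ‖A‖ * ‖J.conjTranspose‖ := by
        rw [hA]
        exact (Matrix.l2_opNorm_mul _ _).trans
          (mul_le_mul_of_nonneg_right (Matrix.l2_opNorm_mul _ _) (norm_nonneg _))
    _ ≤ 1 * ‖A‖ * 1 := by gcongr
    _ = ‖A‖ := by ring

variable {n : ℕ}

/-- The restriction of `A` to the qubits in `R`: all other qubits are set to `0` on both sides of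
`A`, and the resulting operator on `R` is tensored with the identity. -/
def restrict (R : Finset (Fin n)) : Op n →ₗ[ℂ] Op n where
  toFun A := Matrix.of fun x y =>
    if ∀ i ∉ R, x i = y i then A (R.piecewise x 0) (R.piecewise y 0) else 0
  map_add' A B := by ext x y; simp only [Matrix.of_apply, Matrix.add_apply]; split_ifs <;> simp
  map_smul' c A := by ext x y; simp only [Matrix.of_apply, Matrix.smul_apply]; split_ifs <;> simp

lemma restrict_apply (R : Finset (Fin n)) (A : Op n) (x y : Bits n) :
    restrict R A x y = if ∀ i ∉ R, x i = y i then A (R.piecewise x 0) (R.piecewise y 0) else 0 :=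
  rfl

lemma restrict_mem_localAlgebra (R : Finset (Fin n)) (A : Op n) :
    restrict R A ∈ localAlgebra R := by
  refine fun i hi => ⟨fun x y h => ?_, fun x y b h => ?_⟩
  · rw [restrict_apply, if_neg fun H => h (H i hi)]
  · have h1 : ∀ z : Bits n, R.piecewise (Function.update z i b) 0 = R.piecewise z 0 := by
      intro z
      ext j
      by_cases hj : j ∈ R
      · have : j ≠ i := fun e => hi (e ▸ hj)
        simp [hj, this]
      · simp [hj]
    have h2 : (∀ j ∉ R, Function.update x i b j = Function.update y i b j) ↔
        ∀ j ∉ R, x j = y j := by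
      refine forall₂_congr fun j _ => ?_
      rcases eq_or_ne j i with rfl | hj
      · simp [h]
      · simp [hj]
    simp only [restrict_apply, h1, h2]

lemma restrict_univ (A : Op n) : restrict Finset.univ A = A := by
  ext x y
  simp [restrict_apply]

/-- Restricting an operator on `S` from `R ∪ {a}` to `R` has no effect if `a ∉ S`. -/
lemma restrict_insert {S R : Finset (Fin n)} {A : Op n} (hA : A ∈ localAlgebra S) {a : Fin n}
    (ha : a ∉ S) : restrict (insert a R) A = restrict R A := by
  by_cases haR : a ∈ R
  · rw [Finset.insert_eq_of_mem haR]
  ext x y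
  simp only [restrict_apply]
  by_cases h : x a = y a
  · have e : (∀ i ∉ insert a R, x i = y i) ↔ ∀ i ∉ R, x i = y i := by
      refine ⟨fun H i hi => ?_, fun H i hi => H i fun h' => hi (Finset.mem_insert_of_mem h')⟩
      rcases eq_or_ne i a with rfl | hia
      · exact h
      · exact H i (by simp [hia, hi])
    have h1 : ∀ z : Bits n, (R.piecewise z 0 : Bits n) =
        Function.update ((insert a R).piecewise z 0) a 0 := by
      intro z
      ext j
      rcases eq_or_ne j a with rfl | hj
      · simp [haR]
      · by_cases hjR : j ∈ R <;> simp [hj, hjR]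
    rw [h1 x, h1 y, (hA a ha).2 _ _ _ (by simpa using h)]
    simp only [e]
  · rw [if_neg fun H : ∀ i ∉ R, x i = y i => h (H a haR)]
    split_ifs with H
    · exact apply_eq_zero_of_ne hA ha (by simpa using h)
    · rfl

/-- The embedding `M ↦ M ⊗ 1` of the matrices on the qubits in `R`. -/
def tensorOne (R : Finset (Fin n)) :
    Matrix ({i // i ∈ R} → Fin 2) ({i // i ∈ R} → Fin 2) ℂ →⋆ₙₐ[ℂ] Op n where
  toFun M := (M ⊗ₖ (1 : Matrix ({i // i ∉ R} → Fin 2) ({i // i ∉ R} → Fin 2) ℂ)).submatrix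
    (Equiv.piEquivPiSubtypeProd (fun i => i ∈ R) fun _ => Fin 2)
    (Equiv.piEquivPiSubtypeProd (fun i => i ∈ R) fun _ => Fin 2)
  map_smul' c M := by simp [Matrix.smul_kronecker, Matrix.submatrix_smul]
  map_zero' := by simp
  map_add' M N := by simp [Matrix.add_kronecker, Matrix.submatrix_add]
  map_mul' M N := by
    rw [Matrix.submatrix_mul_equiv, ← Matrix.mul_kronecker_mul, one_mul]
  map_star' M := by
    simp only [Matrix.star_eq_conjTranspose, Matrix.conjTranspose_submatrix,
      Matrix.conjTranspose_kronecker, Matrix.conjTranspose_one]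

lemma norm_restrict_le (R : Finset (Fin n)) (A : Op n) : ‖restrict R A‖ ≤ ‖A‖ := by
  let f : ({i // i ∈ R} → Fin 2) → Bits n := fun u =>
    (Equiv.piEquivPiSubtypeProd (fun i => i ∈ R) fun _ => Fin 2).symm (u, 0)
  have hf : Function.Injective f := fun u v h => by
    simpa using (Equiv.injective _ h : (u, (0 : {i // i ∉ R} → Fin 2)) = (v, 0))
  have h : restrict R A = tensorOne R (A.submatrix f f) := by
    have hx : ∀ x : Bits n, f (fun i => x i) = R.piecewise x 0 := by
      intro x
      ext i
      by_cases hi : i ∈ R <;> simp [f, Equiv.piEquivPiSubtypeProd, hi]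
    ext x y
    change _ = A (f fun i => x i) (f fun i => y i) *
      (1 : Matrix ({i // i ∉ R} → Fin 2) ({i // i ∉ R} → Fin 2) ℂ) (fun i => x i) (fun i => y i)
    rw [hx, hx, restrict_apply, Matrix.one_apply]
    have : (∀ i ∉ R, x i = y i) ↔ (fun i : {i // i ∉ R} => x i) = fun i : {i // i ∉ R} => y i := by
      simp [funext_iff]
    simp [this]
  rw [h]
  exact (NonUnitalStarAlgHom.norm_apply_le _ _).trans (l2_opNorm_submatrix_le A hf)

/-- The part of `A` that acts on exactly the qubits in `T`, by inclusion-exclusion. -/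
noncomputable def exactPart (T : Finset (Fin n)) : Op n →ₗ[ℂ] Op n :=
  ∑ R ∈ T.powerset, (-1 : ℂ) ^ (T.card + R.card) • restrict R

lemma exactPart_apply (T : Finset (Fin n)) (A : Op n) :
    exactPart T A = ∑ R ∈ T.powerset, (-1 : ℂ) ^ (T.card + R.card) • restrict R A := by
  simp [exactPart]

lemma exactPart_mem_localAlgebra (T : Finset (Fin n)) (A : Op n) :
    exactPart T A ∈ localAlgebra T := by
  rw [exactPart_apply]
  exact sum_mem fun R hR => SMulMemClass.smul_mem _
    (localAlgebra_mono (Finset.mem_powerset.1 hR) (restrict_mem_localAlgebra R A))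

lemma norm_exactPart_le (T : Finset (Fin n)) (A : Op n) :
    ‖exactPart T A‖ ≤ 2 ^ T.card * ‖A‖ := by
  rw [exactPart_apply]
  calc _ ≤ ∑ R ∈ T.powerset, ‖A‖ := norm_sum_le_of_le _ fun R _ => by
        rw [norm_smul]; simpa using norm_restrict_le R A
    _ = _ := by simp [Finset.card_powerset]

/-- Möbius inversion on the subsets of `S`. -/
lemma sum_powerset_sum_powerset_neg_one_pow {ι M : Type*} [DecidableEq ι] [AddCommGroup M]
    [Module ℂ M] (S : Finset ι) (f : Finset ι → M) :
    ∑ T ∈ S.powerset, ∑ R ∈ T.powerset, (-1 : ℂ) ^ (T.card + R.card) • f R = f S := by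
  induction S using Finset.induction_on generalizing f with
  | empty => simp
  | insert a S ha ih =>
    rw [Finset.sum_powerset_insert ha, ← ih fun R => f (insert a R), ← Finset.sum_add_distrib]
    refine Finset.sum_congr rfl fun T hT => ?_
    have haT : a ∉ T := fun h => ha (Finset.mem_powerset.1 hT h)
    rw [Finset.sum_powerset_insert haT, ← add_assoc, ← Finset.sum_add_distrib,
      Finset.sum_eq_zero, zero_add]
    · refine Finset.sum_congr rfl fun R hR => ?_
      have haR : a ∉ R := fun h => haT (Finset.mem_powerset.1 hR h)
      rw [Finset.card_insert_of_notMem haT, Finset.card_insert_of_notMem haR,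
        show T.card + 1 + (R.card + 1) = T.card + R.card + 2 by ring, pow_add]
      simp
    · intro R _
      rw [Finset.card_insert_of_notMem haT, ← add_smul,
        show T.card + 1 + R.card = T.card + R.card + 1 by ring, pow_succ]
      simp

lemma sum_exactPart (A : Op n) : ∑ T, exactPart T A = A := by
  conv_rhs => rw [← restrict_univ A,
    ← sum_powerset_sum_powerset_neg_one_pow Finset.univ fun R => restrict R A]
  simp [exactPart_apply]

lemma exactPart_eq_zero {S T : Finset (Fin n)} {A : Op n} (hA : A ∈ localAlgebra S)
    (h : ¬ T ⊆ S) : exactPart T A = 0 := by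
  obtain ⟨a, haT, haS⟩ := Finset.not_subset.1 h
  have ha : a ∉ T.erase a := Finset.notMem_erase a T
  rw [exactPart_apply, ← Finset.insert_erase haT, Finset.sum_powerset_insert ha,
    ← Finset.sum_add_distrib]
  refine Finset.sum_eq_zero fun R hR => ?_
  have haR : a ∉ R := fun h => ha (Finset.mem_powerset.1 hR h)
  rw [restrict_insert hA haS, Finset.card_insert_of_notMem haR, ← add_assoc, pow_succ]
  simp

lemma exactPart_eq_zero_of_lt_card {k : ℕ} {T : Finset (Fin n)} {A : Op n} (hA : A ∈ kLocal n k)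
    (h : k < T.card) : exactPart T A = 0 :=
  kLocal_le (M := LinearMap.ker (exactPart T)) (fun _ hS _ hA =>
    exactPart_eq_zero hA fun hT => (h.trans_le (Finset.card_le_card hT)).not_ge hS) hA

/-- The total weight of the decomposition of a `k`-local operator into its exact parts: compare with
the binomial sum `∑ (2 / n) ^ |T| = (1 + 2 / n) ^ n`. -/
lemma sum_two_pow_card_le (hn : 0 < n) (k : ℕ) :
    ∑ T : Finset (Fin n) with T.card ≤ k, (2 : ℝ) ^ T.card ≤ Real.exp 2 * (n : ℝ) ^ k := by
  have hn' : (1 : ℝ) ≤ n := by exact_mod_cast hn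
  have hn0 : (n : ℝ) ≠ 0 := by positivity
  calc ∑ T : Finset (Fin n) with T.card ≤ k, (2 : ℝ) ^ T.card
      ≤ ∑ T : Finset (Fin n) with T.card ≤ k, (2 / n : ℝ) ^ T.card * (n : ℝ) ^ k := by
        refine Finset.sum_le_sum fun T hT => ?_
        calc (2 : ℝ) ^ T.card = (2 / n : ℝ) ^ T.card * (n : ℝ) ^ T.card := by
              rw [← mul_pow, div_mul_cancel₀ _ hn0]
          _ ≤ _ := by
              have := (Finset.mem_filter.1 hT).2
              gcongr
    _ ≤ ∑ T : Finset (Fin n), (2 / n : ℝ) ^ T.card * (n : ℝ) ^ k :=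
        Finset.sum_le_sum_of_subset_of_nonneg (Finset.filter_subset _ _)
          fun _ _ _ => by positivity
    _ = (2 / n + 1 : ℝ) ^ n * (n : ℝ) ^ k := by
        rw [← Finset.sum_mul]
        simpa using congrArg (· * (n : ℝ) ^ k)
          (Fintype.sum_pow_mul_eq_add_pow (Fin n) (2 / n : ℝ) 1)
    _ ≤ Real.exp (2 / n) ^ n * (n : ℝ) ^ k := by
        gcongr
        exact Real.add_one_le_exp _
    _ = Real.exp 2 * (n : ℝ) ^ k := by
        rw [← Real.exp_nat_mul, mul_div_cancel₀ _ hn0]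

/-- A map that approximately preserves the operators on few qubits approximately preserves the
`k`-local operators, at the price of the total weight of their decomposition. -/
lemma exists_kLocal_approx (hn : 0 < n) {k l : ℕ} {δ : ℝ} (hδ : 0 ≤ δ) (Φ : Op n →ₗ[ℂ] Op n)
    (hΦ : ∀ S : Finset (Fin n), S.card ≤ k → ∀ A ∈ localAlgebra S,
      ∃ B ∈ kLocal n l, ‖B - Φ A‖ ≤ δ * ‖A‖) {K : Op n} (hK : K ∈ kLocal n k) :
    ∃ B ∈ kLocal n l, ‖B - Φ K‖ ≤ δ * (Real.exp 2 * (n : ℝ) ^ k) * ‖K‖ := by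
  have hsum : ∑ T : Finset (Fin n) with T.card ≤ k, exactPart T K = K := by
    conv_rhs => rw [← sum_exactPart K]
    refine Finset.sum_subset (Finset.subset_univ _) fun T _ hT => ?_
    exact exactPart_eq_zero_of_lt_card hK (by simpa using hT)
  have hT : ∀ T : Finset (Fin n), ∃ B : Op n, T.card ≤ k →
      B ∈ kLocal n l ∧ ‖B - Φ (exactPart T K)‖ ≤ δ * ‖exactPart T K‖ := by
    intro T
    by_cases h : T.card ≤ k
    · obtain ⟨B, hB⟩ := hΦ T h _ (exactPart_mem_localAlgebra T K)
      exact ⟨B, fun _ => hB⟩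
    · exact ⟨0, fun h' => absurd h' h⟩
  choose B hB using hT
  refine ⟨∑ T : Finset (Fin n) with T.card ≤ k, B T,
    Submodule.sum_mem _ fun T hT => (hB T (Finset.mem_filter.1 hT).2).1, ?_⟩
  conv_lhs => rw [← hsum, map_sum, ← Finset.sum_sub_distrib]
  calc _ ≤ ∑ T : Finset (Fin n) with T.card ≤ k, δ * (2 ^ T.card * ‖K‖) :=
        norm_sum_le_of_le _ fun T hT => (hB T (Finset.mem_filter.1 hT).2).2.trans
          (mul_le_mul_of_nonneg_left (norm_exactPart_le T K) hδ)
    _ = δ * (∑ T : Finset (Fin n) with T.card ≤ k, (2 : ℝ) ^ T.card) * ‖K‖ := by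
        rw [Finset.mul_sum, Finset.sum_mul]
        exact Finset.sum_congr rfl fun T _ => by ring
    _ ≤ _ := by gcongr; exact sum_two_pow_card_le hn k

end Decomposition

/-! ### Local approximation of product states -/

section ProductState

open scoped Matrix.Norms.L2Operator

variable {n : ℕ}

/-- The tensor product of single-qubit operators. -/
def productOp (u : Fin n → Matrix (Fin 2) (Fin 2) ℂ) : Op n :=
  Matrix.of fun x y => ∏ i, u i (x i) (y i)

lemma productOp_apply (u : Fin n → Matrix (Fin 2) (Fin 2) ℂ) (x y : Bits n) :
    productOp u x y = ∏ i, u i (x i) (y i) := rfl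

lemma productOp_mul (u w : Fin n → Matrix (Fin 2) (Fin 2) ℂ) :
    productOp u * productOp w = productOp fun i => u i * w i := by
  ext x y
  simp only [Matrix.mul_apply, productOp_apply, Finset.prod_univ_sum, Fintype.piFinset_univ,
    Finset.prod_mul_distrib]

lemma productOp_diagonal (d : Fin n → Fin 2 → ℂ) :
    productOp (fun i => Matrix.diagonal (d i)) = Matrix.diagonal fun z => ∏ i, d i (z i) := by
  ext x y
  rw [productOp_apply, Matrix.diagonal_apply]
  split_ifs with h
  · simp [h]
  · obtain ⟨i, hi⟩ := Function.ne_iff.1 h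
    exact Finset.prod_eq_zero (Finset.mem_univ i) (Matrix.diagonal_apply_ne _ hi)

lemma productOp_conjTranspose (u : Fin n → Matrix (Fin 2) (Fin 2) ℂ) :
    (productOp u).conjTranspose = productOp fun i => (u i).conjTranspose := by
  ext x y
  simp [productOp_apply, Matrix.conjTranspose_apply]

lemma productOp_mem_localAlgebra {u : Fin n → Matrix (Fin 2) (Fin 2) ℂ} {S : Finset (Fin n)}
    (hu : ∀ i ∉ S, u i = 1) : productOp u ∈ localAlgebra S := by
  refine fun i hi => ⟨fun x y h => ?_, fun x y b h => ?_⟩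
  · refine Finset.prod_eq_zero (Finset.mem_univ i) ?_
    rw [hu i hi, Matrix.one_apply_ne h]
  · rw [productOp_apply, productOp_apply]
    refine Finset.prod_congr rfl fun j _ => ?_
    rcases eq_or_ne j i with rfl | hj
    · simp [hu j hi, h]
    · simp [hj]

/-- A single-qubit unitary that maps `|0⟩` to `φ`. -/
noncomputable def basisChange (φ : EuclideanSpace ℂ (Fin 2)) : Matrix (Fin 2) (Fin 2) ℂ :=
  !![φ 0, -star (φ 1); φ 1, star (φ 0)]

lemma basisChange_mul_conjTranspose {φ : EuclideanSpace ℂ (Fin 2)} (hφ : ‖φ‖ = 1) :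
    basisChange φ * (basisChange φ).conjTranspose = 1 := by
  have h : φ 0 * star (φ 0) + φ 1 * star (φ 1) = 1 := by
    have := EuclideanSpace.norm_sq_eq φ
    rw [hφ, Fin.sum_univ_two] at this
    have h2 : ∀ z : ℂ, z * star z = ((‖z‖ ^ 2 : ℝ) : ℂ) := by
      intro z; rw [Complex.star_def, Complex.mul_conj, Complex.normSq_eq_norm_sq]
    rw [h2, h2, ← Complex.ofReal_add, ← this]
    simp
  ext a b
  fin_cases a <;> fin_cases b <;>
    simp only [basisChange, Matrix.mul_apply, Matrix.conjTranspose_apply, Fin.sum_univ_two] <;>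
    simp <;> simp at h <;> first | ring1 | linear_combination h

lemma norm_conj_le {U : Op n} (hU : U.conjTranspose * U = 1) (A : Op n) :
    ‖U * A * U.conjTranspose‖ ≤ ‖A‖ := by
  have hUn : ‖U‖ ≤ 1 := by
    have := Matrix.l2_opNorm_conjTranspose_mul_self U
    rw [hU] at this
    have h2 := l2_opNorm_one_le (ι := Bits n)
    nlinarith [norm_nonneg U]
  calc _ ≤ ‖U‖ * ‖A‖ * ‖U.conjTranspose‖ :=
        (norm_mul_le _ _).trans (mul_le_mul_of_nonneg_right (norm_mul_le _ _) (norm_nonneg _))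
    _ ≤ 1 * ‖A‖ * 1 := by
        rw [Matrix.l2_opNorm_conjTranspose]
        gcongr
    _ = ‖A‖ := by ring

lemma productOp_mul_conjTranspose {u : Fin n → Matrix (Fin 2) (Fin 2) ℂ}
    (hu : ∀ i, u i * (u i).conjTranspose = 1) :
    productOp u * (productOp u).conjTranspose = 1 := by
  rw [productOp_conjTranspose, productOp_mul]
  simp_rw [hu, ← Matrix.diagonal_one]
  rw [productOp_diagonal]
  simp

/-- A pure product state is the image of `|0⋯0⟩⟨0⋯0|` under a product unitary. -/
lemma IsPureProductState.exists_eq_conj {ρ : Op n} (hρ : IsPureProductState ρ) :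
    ∃ u : Fin n → Matrix (Fin 2) (Fin 2) ℂ, (∀ i, u i * (u i).conjTranspose = 1) ∧
      ρ = productOp u * Matrix.diagonal (fun z => if z = 0 then 1 else 0) *
        (productOp u).conjTranspose := by
  obtain ⟨ψ, hψ, hρ⟩ := hρ
  refine ⟨fun i => basisChange (ψ i), fun i => basisChange_mul_conjTranspose (hψ i), ?_⟩
  ext x y
  rw [Matrix.mul_apply, Finset.sum_eq_single 0 (fun z _ hz => by simp [hz]) (by simp), hρ]
  simp [productOp_apply, basisChange]
  congr 1
  all_goals
    refine Finset.prod_congr rfl fun i _ => ?_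
    first
      | generalize x i = b
        fin_cases b <;> simp
      | generalize y i = b
        fin_cases b <;> simp

lemma IsPureProductState.norm_le_one {ρ : Op n} (hρ : IsPureProductState ρ) : ‖ρ‖ ≤ 1 := by
  obtain ⟨u, hu, rfl⟩ := hρ.exists_eq_conj
  refine (norm_conj_le (mul_eq_one_comm.1 (productOp_mul_conjTranspose hu)) _).trans ?_
  rw [Matrix.l2_opNorm_diagonal, pi_norm_le_iff_of_nonneg zero_le_one]
  intro z
  split_ifs <;> simp

/-- A polynomial `q` with `q(0) = 1` that is small on `{1, …, n}` turns the number operator, in the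
product basis containing the given product state, into a local approximation of the state. -/
lemma exists_kLocal_approx_of_polynomial {ρ : Op n} (hρ : IsPureProductState ρ)
    {q : Polynomial ℝ} {d : ℕ} (hd : q.natDegree ≤ d) {ε : ℝ} (hε : 0 ≤ ε) (h0 : q.eval 0 = 1)
    (hq : ∀ j : ℕ, 1 ≤ j → j ≤ n → |q.eval (j : ℝ)| ≤ ε) :
    ∃ K ∈ kLocal n d, ‖K - ρ‖ ≤ ε := by
  obtain ⟨u, hu, hρV⟩ := hρ.exists_eq_conj
  set V : Op n := productOp u with hV
  have hVV : V * V.conjTranspose = 1 := productOp_mul_conjTranspose hu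
  have hVV' : V.conjTranspose * V = 1 := mul_eq_one_comm.1 hVV
  set N : Op n := V * Matrix.diagonal (fun z => (hammingNorm z : ℂ)) * V.conjTranspose with hN
  have hN1 : N ∈ kLocal n 1 := by
    have h1 : ∀ z : Bits n, (hammingNorm z : ℂ) =
        ∑ i, ∏ j, (if j = i then ![0, 1] else 1 : Fin 2 → ℂ) (z j) := by
      intro z
      rw [hammingNorm, Finset.card_filter]
      push_cast
      refine Finset.sum_congr rfl fun i _ => ?_
      rw [Finset.prod_eq_single i (fun j _ hj => by simp [hj]) (by simp)]
      generalize z i = b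
      fin_cases b <;> simp
    have h2 : Matrix.diagonal (fun z : Bits n => (hammingNorm z : ℂ)) =
        ∑ i, productOp fun j => Matrix.diagonal (if j = i then ![0, 1] else 1 : Fin 2 → ℂ) := by
      simp_rw [productOp_diagonal]
      ext x y
      simp only [Matrix.sum_apply, Matrix.diagonal_apply]
      split_ifs
      · exact h1 x
      · simp
    rw [hN, h2, Finset.mul_sum, Finset.sum_mul]
    refine Submodule.sum_mem _ fun i _ => mem_kLocal_of_mem_localAlgebra (S := {i}) (by simp) ?_
    rw [hV, productOp_conjTranspose, productOp_mul, productOp_mul]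
    refine productOp_mem_localAlgebra fun j hj => ?_
    have hj' : j ≠ i := by simpa using hj
    simp only [hj', if_false]
    rw [show (1 : Fin 2 → ℂ) = fun _ => 1 from rfl, Matrix.diagonal_one, mul_one,
      hu j]
  have hNpow : ∀ j : ℕ, N ^ j =
      V * Matrix.diagonal (fun z => (hammingNorm z : ℂ) ^ j) * V.conjTranspose := by
    intro j
    induction j with
    | zero => simp [hVV]
    | succ j ih =>
      rw [pow_succ, ih, hN, show ∀ A B : Op n, V * A * V.conjTranspose * (V * B * V.conjTranspose) =
        V * (A * (V.conjTranspose * V) * B) * V.conjTranspose by intros; simp only [mul_assoc],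
        hVV', mul_one, Matrix.diagonal_mul_diagonal]
      simp_rw [pow_succ]
  refine ⟨∑ j ∈ Finset.range (d + 1), (q.coeff j : ℂ) • N ^ j,
    by simpa only [mul_one] using sum_smul_pow_mem_kLocal hN1 d fun j => (q.coeff j : ℂ), ?_⟩
  have hK : ∑ j ∈ Finset.range (d + 1), (q.coeff j : ℂ) • N ^ j =
      V * Matrix.diagonal (fun z => ((q.eval (hammingNorm z : ℝ) : ℝ) : ℂ)) * V.conjTranspose := by
    have h1 : ∀ j, (q.coeff j : ℂ) • N ^ j = V * ((q.coeff j : ℂ) •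
        Matrix.diagonal fun z => (hammingNorm z : ℂ) ^ j) * V.conjTranspose := fun j => by
      rw [hNpow, Matrix.mul_smul, Matrix.smul_mul]
    simp_rw [h1]
    rw [← Finset.sum_mul, ← Finset.mul_sum]
    congr 2
    ext x y
    rw [Matrix.sum_apply]
    simp only [Matrix.smul_apply, Matrix.diagonal_apply]
    split_ifs
    · rw [Polynomial.eval_eq_sum_range' (Nat.lt_succ_of_le hd)]
      simp
    · simp
  rw [hK, hρV, ← sub_mul, ← mul_sub, Matrix.diagonal_sub]
  refine (norm_conj_le hVV' _).trans ?_
  rw [Matrix.l2_opNorm_diagonal, pi_norm_le_iff_of_nonneg hε]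
  intro z
  by_cases hz : z = 0
  · simpa [hz, h0] using hε
  · have h1 : 1 ≤ hammingNorm z := hammingNorm_pos_iff.2 hz
    have h2 : hammingNorm z ≤ n := by simpa using hammingNorm_le_card_fintype (x := z)
    simpa [hz] using hq _ h1 h2

open Polynomial in
/-- Chebyshev polynomials, rescaled from `[-1, 1]` to an interval containing `{1, …, n}`, have value
`1` at `0` and are exponentially small in `d / √n` on `{1, …, n}`. -/
lemma exists_polynomial_small (hn : 0 < n) (d : ℕ) :
    ∃ q : ℝ[X], q.natDegree ≤ d ∧ q.eval 0 = 1 ∧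
      ∀ j : ℕ, 1 ≤ j → j ≤ n → |q.eval (j : ℝ)| ≤ 2 * Real.exp (-(d / Real.sqrt n)) := by
  have hn' : (1 : ℝ) ≤ n := by exact_mod_cast hn
  set t : ℝ := 1 / Real.sqrt n with ht
  set c : ℝ := Real.cosh t with hc
  have hc1 : 1 ≤ c := Real.one_le_cosh t
  -- `cosh t ≤ exp (1 / (2 n)) ≤ 1 + 1 / n` makes the image of `n` at least `-1`.
  have hcn : (c - 1) * n ≤ 1 := by
    have h1 : t ^ 2 / 2 = 1 / (2 * n) := by
      rw [ht, div_pow, Real.sq_sqrt (by positivity)]; field_simp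
    have h2 : c ≤ Real.exp (1 / (2 * n)) := h1 ▸ Real.cosh_le_exp_half_sq t
    have h3 := Real.add_one_le_exp (-(1 / (2 * n) : ℝ))
    have h4 : Real.exp (1 / (2 * n)) * Real.exp (-(1 / (2 * n) : ℝ)) = 1 := by
      rw [← Real.exp_add]; simp
    have h5 : (1 / (2 * n) : ℝ) * n = 1 / 2 := by field_simp
    set s : ℝ := 1 / (2 * n)
    have hs : 0 < s := by positivity
    have h6 : c * (1 - s) ≤ 1 := by
      have : 0 ≤ 1 - s := by nlinarith
      nlinarith [Real.exp_pos s]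
    nlinarith
  have hcosh : 0 < Real.cosh (d * t) := Real.cosh_pos _
  refine ⟨C (Real.cosh (d * t))⁻¹ * (Chebyshev.T ℝ d).comp (C (1 - c) * X + C c), ?_, ?_, ?_⟩
  · refine (natDegree_C_mul_le _ _).trans (natDegree_comp_le.trans ?_)
    have h1 : (Chebyshev.T ℝ d).natDegree ≤ d := by simp [Chebyshev.natDegree_T]
    calc _ ≤ d * 1 := Nat.mul_le_mul h1 natDegree_linear_le
      _ = d := mul_one d
  · simp only [eval_mul, eval_C, eval_comp, eval_add, eval_X, mul_zero, zero_add]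
    rw [hc, Chebyshev.T_real_cosh]
    exact inv_mul_cancel₀ hcosh.ne'
  · intro j hj hjn
    have hj' : (1 : ℝ) ≤ j := by exact_mod_cast hj
    have hjn' : (j : ℝ) ≤ n := by exact_mod_cast hjn
    simp only [eval_mul, eval_C, eval_comp, eval_add, eval_X]
    have h1 : |(Chebyshev.T ℝ d).eval ((1 - c) * j + c)| ≤ 1 := by
      refine Chebyshev.abs_eval_T_real_le_one _ (abs_le.2 ⟨?_, ?_⟩) <;> nlinarith
    have h2 : (Real.cosh (d * t))⁻¹ ≤ 2 * Real.exp (-(d / Real.sqrt n)) := by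
      rw [inv_le_comm₀ hcosh (by positivity), mul_inv, Real.exp_neg, inv_inv, Real.cosh_eq,
        show (d : ℝ) / Real.sqrt n = d * t by rw [ht]; ring]
      nlinarith [Real.exp_pos (-(d * t))]
    rw [abs_mul, abs_of_pos (inv_pos.2 hcosh)]
    calc _ ≤ 2 * Real.exp (-(d / Real.sqrt n)) * 1 := by gcongr
      _ = _ := mul_one _

lemma IsPureProductState.exists_kLocal_approx {ρ : Op n} (hρ : IsPureProductState ρ) (hn : 0 < n)
    (d : ℕ) : ∃ K ∈ kLocal n d, ‖K - ρ‖ ≤ 2 * Real.exp (-(d / Real.sqrt n)) := by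
  obtain ⟨q, hd, h0, hq⟩ := exists_polynomial_small hn d
  exact exists_kLocal_approx_of_polynomial hρ hd (by positivity) h0 hq

end ProductState

/-! ### Evolution of local operators under commuting Hamiltonians -/

section Evolution

open scoped Matrix.Norms.L2Operator

variable {n ℓ : ℕ}

/-- Taylor approximation of the exponential. The tail `∑_{j > d} h ^ j / j!` is at most
`e ^ (-d) ∑_j (e h) ^ j / j!`. -/
lemma norm_exp_sub_sum_le (X : Op n) {h : ℝ} (hX : ‖X‖ ≤ h) (d : ℕ) :
    ‖NormedSpace.exp X - ∑ j ∈ Finset.range (d + 1), ((Nat.factorial j : ℂ)⁻¹) • X ^ j‖ ≤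
      Real.exp (Real.exp 1 * h - d) := by
  have hh : 0 ≤ h := (norm_nonneg X).trans hX
  have h1 := (hasSum_nat_add_iff' (d + 1)).2 (NormedSpace.exp_series_hasSum_exp' (𝕂 := ℂ) X)
  have h2 : HasSum (fun j : ℕ => (Real.exp 1 * h) ^ j / (Nat.factorial j : ℝ))
      (Real.exp (Real.exp 1 * h)) := by
    rw [Real.exp_eq_exp_ℝ]
    exact NormedSpace.expSeries_div_hasSum_exp _
  have h3 := ((hasSum_nat_add_iff' (d + 1)).2 h2).mul_left (Real.exp (-d))
  refine (h1.norm_le_of_bounded h3 fun j => ?_).trans ?_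
  · have h4 : ‖X ^ (j + (d + 1))‖ ≤ h ^ (j + (d + 1)) :=
      (norm_pow_le' X (by omega)).trans (by gcongr)
    have h5 : (1 : ℝ) ≤ Real.exp (-d) * Real.exp 1 ^ (j + (d + 1)) := by
      rw [← Real.exp_nat_mul, ← Real.exp_add, Real.one_le_exp_iff]
      push_cast
      linarith [(Nat.cast_nonneg j : (0 : ℝ) ≤ j)]
    rw [norm_smul, norm_inv, Complex.norm_natCast, mul_pow]
    calc _ ≤ ((Nat.factorial (j + (d + 1)) : ℝ))⁻¹ * (1 * h ^ (j + (d + 1))) := by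
          rw [one_mul]; gcongr
      _ ≤ ((Nat.factorial (j + (d + 1)) : ℝ))⁻¹ *
          (Real.exp (-d) * Real.exp 1 ^ (j + (d + 1)) * h ^ (j + (d + 1))) := by gcongr
      _ = _ := by ring
  · rw [sub_eq_add_neg (Real.exp 1 * h), Real.exp_add, mul_comm (Real.exp (Real.exp 1 * h))]
    gcongr
    exact sub_le_self _ (Finset.sum_nonneg fun j _ => by positivity)

namespace CommutingHamiltonian

lemma isHermitian_subset (H : CommutingHamiltonian n ℓ) (S : Finset (Fin n)) :
    (H.subset S).IsHermitian := by
  classical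
  rw [Matrix.IsHermitian, subset, Matrix.conjTranspose_sum]
  exact Finset.sum_congr rfl fun j _ => H.isHermitian_term j

lemma isHermitian_total (H : CommutingHamiltonian n ℓ) : H.total.IsHermitian := by
  rw [Matrix.IsHermitian, total, Matrix.conjTranspose_sum]
  exact Finset.sum_congr rfl fun j _ => H.isHermitian_term j

lemma term_mem_kLocal (H : CommutingHamiltonian n ℓ) (j : Fin H.numTerms) :
    H.term j ∈ kLocal n ℓ :=
  Submodule.subset_span (H.card_support_term_le j)

lemma subset_mem_kLocal (H : CommutingHamiltonian n ℓ) (S : Finset (Fin n)) :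
    H.subset S ∈ kLocal n ℓ :=
  Submodule.sum_mem _ fun j _ => H.term_mem_kLocal j

end CommutingHamiltonian

lemma neg_I_smul_mem_skewAdjoint {A : Op n} (hA : A.IsHermitian) :
    -(Complex.I • A) ∈ skewAdjoint (Op n) := by
  rw [skewAdjoint.mem_iff, star_neg, star_smul, Matrix.star_eq_conjTranspose, hA.eq]
  simp

lemma exp_mem_unitary_of_isHermitian {A : Op n} (hA : A.IsHermitian) :
    NormedSpace.exp (-(Complex.I • A)) ∈ unitary (Op n) :=
  letI : NormedAlgebra ℚ (Op n) := .restrictScalars ℚ ℂ (Op n)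
  NormedSpace.exp_mem_unitary_of_mem_skewAdjoint (neg_I_smul_mem_skewAdjoint hA)

lemma norm_le_one_of_mem_unitary {U : Op n} (hU : U ∈ unitary (Op n)) : ‖U‖ ≤ 1 := by
  have h := Matrix.l2_opNorm_conjTranspose_mul_self U
  rw [← Matrix.star_eq_conjTranspose, Unitary.star_mul_self_of_mem hU] at h
  nlinarith [norm_nonneg U, l2_opNorm_one_le (ι := Bits n)]

/-- Only the terms of the Hamiltonian that touch the support of an operator contribute to its
evolution, since the terms commute with each other. -/
lemma CommutingHamiltonian.unitary_conj_eq (H : CommutingHamiltonian n ℓ) {S : Finset (Fin n)}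
    {A : Op n} (hA : A ∈ localAlgebra S) :
    H.unitary * A * star H.unitary =
      NormedSpace.exp (-(Complex.I • H.subset S)) * A *
        star (NormedSpace.exp (-(Complex.I • H.subset S))) := by
  classical
  set R : Op n := ∑ j with ¬ (support (H.term j) ∩ S).Nonempty, H.term j with hR
  have htot : H.total = H.subset S + R := by
    rw [hR, total, subset]
    convert (Finset.sum_filter_add_sum_filter_not Finset.univ
      (fun j => (support (H.term j) ∩ S).Nonempty) H.term).symm
  have hRh : R.IsHermitian := by
    rw [Matrix.IsHermitian, hR, Matrix.conjTranspose_sum]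
    exact Finset.sum_congr rfl fun j _ => H.isHermitian_term j
  have hcomm : Commute (H.subset S) R :=
    Commute.sum_left _ _ _ fun i _ => Commute.sum_right _ _ _ fun j _ => H.commute_term i j
  have hAR : Commute A R := Commute.sum_right _ _ _ fun j hj => by
    refine commute_of_disjoint ?_ hA (mem_localAlgebra_support (H.term j))
    rw [Finset.mem_filter, Finset.not_nonempty_iff_eq_empty,
      ← Finset.disjoint_iff_inter_eq_empty] at hj
    exact hj.2.symm
  set E := NormedSpace.exp (-(Complex.I • H.subset S))
  set F := NormedSpace.exp (-(Complex.I • R))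
  have hU : H.unitary = E * F := by
    rw [CommutingHamiltonian.unitary, htot, smul_add, neg_add]
    exact Matrix.exp_add_of_commute _ _
      ((hcomm.smul_left _).smul_right _).neg_left.neg_right
  have hAF : A * F = F * A := ((hAR.smul_right _).neg_right).exp_right
  have hFF : F * star F = 1 := Unitary.mul_star_self_of_mem (exp_mem_unitary_of_isHermitian hRh)
  rw [hU, star_mul]
  calc E * F * A * (star F * star E) = E * (F * A) * star F * star E := by
        simp only [mul_assoc]
    _ = E * A * (F * star F) * star E := by rw [← hAF]; simp only [mul_assoc]
    _ = E * A * star E := by rw [hFF, mul_one]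

lemma CommutingHamiltonian.unitary_mem_unitary (H : CommutingHamiltonian n ℓ) :
    H.unitary ∈ _root_.unitary (Op n) :=
  exp_mem_unitary_of_isHermitian H.isHermitian_total

/-- If `‖X‖ ≤ h` for the generator `X` of `e ^ X`, a Taylor polynomial of degree a bit larger than
`e h` replaces `e ^ X`. -/
lemma CommutingHamiltonian.exists_kLocal_approx_of_mem_localAlgebra
    (H : CommutingHamiltonian n ℓ) {S : Finset (Fin n)} {h δ : ℝ} (hS : ‖H.subset S‖ ≤ h) {d : ℕ}
    (hδ : Real.exp (Real.exp 1 * h - d) ≤ δ) (hδ1 : δ ≤ 1) {A : Op n} (hA : A ∈ localAlgebra S) :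
    ∃ B ∈ kLocal n (d * ℓ + S.card + d * ℓ),
      ‖B - H.unitary * A * star H.unitary‖ ≤ 3 * δ * ‖A‖ := by
  set X : Op n := -(Complex.I • H.subset S) with hX
  have hXl : X ∈ kLocal n ℓ :=
    Submodule.neg_mem _ (Submodule.smul_mem _ _ (H.subset_mem_kLocal S))
  have hXn : ‖X‖ ≤ h := by rw [hX, norm_neg, norm_smul]; simpa using hS
  set T : Op n := ∑ j ∈ Finset.range (d + 1), ((Nat.factorial j : ℂ)⁻¹) • X ^ j with hT
  have hTl : T ∈ kLocal n (d * ℓ) :=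
    sum_smul_pow_mem_kLocal hXl d fun j => ((Nat.factorial j : ℂ)⁻¹)
  set E := NormedSpace.exp X with hE
  have hTE : ‖T - E‖ ≤ δ := by
    rw [norm_sub_rev]
    exact (norm_exp_sub_sum_le X hXn d).trans hδ
  have hE1 : ‖E‖ ≤ 1 := norm_le_one_of_mem_unitary
    (exp_mem_unitary_of_isHermitian (H.isHermitian_subset S))
  have hδ0 : 0 ≤ δ := (norm_nonneg _).trans hTE
  have hT2 : ‖T‖ ≤ 2 := by
    calc ‖T‖ = ‖(T - E) + E‖ := by rw [sub_add_cancel]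
      _ ≤ δ + 1 := norm_add_le_of_le hTE hE1
      _ ≤ 2 := by linarith
  refine ⟨T * A * star T, mul_mem_kLocal (mul_mem_kLocal hTl
    (mem_kLocal_of_mem_localAlgebra le_rfl hA)) (star_mem_kLocal hTl), ?_⟩
  rw [H.unitary_conj_eq hA, ← hX, ← hE]
  have e : T * A * star T - E * A * star E = (T - E) * A * star T + E * A * star (T - E) := by
    rw [star_sub]; noncomm_ring
  rw [e]
  have n3 : ∀ P Q R : Op n, ‖P * Q * R‖ ≤ ‖P‖ * ‖Q‖ * ‖R‖ := fun P Q R =>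
    (norm_mul_le _ _).trans (mul_le_mul_of_nonneg_right (norm_mul_le _ _) (norm_nonneg _))
  calc _ ≤ ‖T - E‖ * ‖A‖ * ‖star T‖ + ‖E‖ * ‖A‖ * ‖star (T - E)‖ :=
        norm_add_le_of_le (n3 _ _ _) (n3 _ _ _)
    _ ≤ δ * ‖A‖ * 2 + 1 * ‖A‖ * δ := by rw [norm_star, norm_star]; gcongr
    _ = 3 * δ * ‖A‖ := by ring

/-- One layer of the evolution turns a `k`-local operator into an approximately
`(k + 2 d ℓ)`-local one, where `d` exceeds a multiple of `n ^ α k ^ (1 - α)`. -/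
lemma CommutingHamiltonian.exists_kLocal_approx (H : CommutingHamiltonian n ℓ) {α C : ℝ}
    (hα : α ≤ 1) (hC : 0 ≤ C) (hH : H.SubsetNormBound α C) (hn : 0 < n) {k d : ℕ} {δ : ℝ}
    (hδ : Real.exp (Real.exp 1 * (C * (n : ℝ) ^ α * (k : ℝ) ^ (1 - α)) - d) ≤ δ) (hδ1 : δ ≤ 1)
    {K : Op n} (hK : K ∈ kLocal n k) :
    ∃ B ∈ kLocal n (k + 2 * (d * ℓ)), ‖B - H.unitary * K * star H.unitary‖ ≤
      3 * δ * (Real.exp 2 * (n : ℝ) ^ k) * ‖K‖ := by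
  have hδ0 : 0 ≤ δ := (Real.exp_pos _).le.trans hδ
  refine DenseEvolution.exists_kLocal_approx hn (by positivity)
    (LinearMap.mulRight ℂ (star H.unitary) ∘ₗ LinearMap.mulLeft ℂ H.unitary)
    (fun S hS A hA => ?_) hK
  have hS' : ‖H.subset S‖ ≤ C * (n : ℝ) ^ α * (k : ℝ) ^ (1 - α) := by
    refine (hH S).trans ?_
    have : (S.card : ℝ) ≤ k := by exact_mod_cast hS
    have : 0 ≤ 1 - α := by linarith
    gcongr
  obtain ⟨B, hB, hBn⟩ := H.exists_kLocal_approx_of_mem_localAlgebra hS' hδ hδ1 hA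
  exact ⟨B, kLocal_mono (by omega) hB, hBn⟩

end Evolution

/-! ### Concentration of the Hamming weight -/

section Concentration

open scoped Matrix.Norms.L2Operator

variable {n ℓ : ℕ}

/-- For a pure state, `Pr[W ∈ E]` is the squared norm of the part of the state vector on the strings
whose weight lies in `E`. -/
lemma weightPr_vecMulVec (φ : Bits n → ℂ) (E : Set ℝ) [DecidablePred (· ∈ E)] :
    weightPr (Matrix.vecMulVec φ (star φ)) E =
      ∑ x with (hammingNorm x : ℝ) ∈ E, ‖φ x‖ ^ 2 := by
  have h : ∀ x, (Matrix.vecMulVec φ (star φ) x x).re = ‖φ x‖ ^ 2 := by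
    intro x
    rw [Matrix.vecMulVec_apply, Pi.star_apply, Complex.star_def, Complex.mul_conj,
      Complex.normSq_eq_norm_sq, Complex.ofReal_re]
  simp only [weightPr, weightProb, h]
  rw [← Finset.sum_fiberwise_of_maps_to (s := Finset.univ.filter fun x : Bits n =>
    (hammingNorm x : ℝ) ∈ E) (t := (Finset.range (n + 1)).filter fun w : ℕ => (w : ℝ) ∈ E)
    (g := hammingNorm)]
  · refine Finset.sum_congr (by congr) fun w hw => Finset.sum_congr ?_ fun _ _ => rfl
    ext x
    have hw' : (w : ℝ) ∈ E := (Finset.mem_filter.1 hw).2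
    simp only [Finset.mem_filter, Finset.mem_univ, true_and]
    exact ⟨fun h => ⟨h ▸ hw', h⟩, fun h => h.2⟩
  · intro x hx
    have : hammingNorm x ≤ n := by simpa using hammingNorm_le_card_fintype (x := x)
    simpa [Nat.lt_succ_iff, this] using hx

/-- A pure state close to a `k`-local operator cannot have much weight on both of two sets of
strings at distance more than `k`: the local operator has no matrix entries between them. -/
lemma sum_mul_sum_le_of_kLocal_approx {φ : Bits n → ℂ} {k : ℕ} {K : Op n} (hK : K ∈ kLocal n k)
    {ε : ℝ} (hKρ : ‖K - Matrix.vecMulVec φ (star φ)‖ ≤ ε) {P Q : Finset (Bits n)}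
    (hPQ : ∀ x ∈ P, ∀ y ∈ Q, k < hammingDist x y) :
    (∑ x ∈ P, ‖φ x‖ ^ 2) * ∑ y ∈ Q, ‖φ y‖ ^ 2 ≤ ε ^ 2 := by
  classical
  set a := ∑ x ∈ P, ‖φ x‖ ^ 2
  set b := ∑ y ∈ Q, ‖φ y‖ ^ 2 with hb
  have ha0 : 0 ≤ a := Finset.sum_nonneg fun _ _ => by positivity
  have hb0 : 0 ≤ b := Finset.sum_nonneg fun _ _ => by positivity
  have hε : 0 ≤ ε := (norm_nonneg _).trans hKρ
  set M : Op n := K - Matrix.vecMulVec φ (star φ) with hM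
  set v : EuclideanSpace ℂ (Bits n) := WithLp.toLp 2 fun y => if y ∈ Q then φ y else 0 with hv
  have hvn : ‖v‖ ^ 2 = b := by
    rw [EuclideanSpace.norm_sq_eq, hb, ← Finset.sum_filter_add_sum_filter_not Finset.univ (· ∈ Q)]
    rw [Finset.sum_eq_zero (s := Finset.univ.filter fun y => ¬ y ∈ Q), add_zero]
    · rw [Finset.filter_mem_eq_inter, Finset.univ_inter]
      exact Finset.sum_congr rfl fun y hy => by simp [hv, hy]
    · intro y hy
      simp [hv, (Finset.mem_filter.1 hy).2]
  have hMv : ∀ x ∈ P, (M.mulVec v) x = -(φ x * b) := by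
    intro x hx
    have h1 : ∀ y, M x y * v y = if y ∈ Q then -(φ x * (‖φ y‖ ^ 2 : ℝ)) else 0 := by
      intro y
      by_cases hy : y ∈ Q
      · rw [hM, Matrix.sub_apply, apply_eq_zero_of_lt_hammingDist hK (hPQ x hx y hy), zero_sub,
          Matrix.vecMulVec_apply, Pi.star_apply, ← Complex.normSq_eq_norm_sq, ← Complex.mul_conj]
        simp only [hv, hy, if_true, Complex.star_def]
        ring
      · simp [hv, hy]
    rw [Matrix.mulVec, dotProduct]
    simp_rw [h1]
    rw [Finset.sum_ite_mem, Finset.univ_inter, Finset.sum_neg_distrib, ← Finset.mul_sum,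
      ← Complex.ofReal_sum]
  have h1 : ‖(EuclideanSpace.equiv (Bits n) ℂ).symm (M.mulVec v)‖ ≤ ε * ‖v‖ :=
    (M.l2_opNorm_mulVec v).trans (by gcongr)
  have h2 : a * b ^ 2 ≤ ‖(EuclideanSpace.equiv (Bits n) ℂ).symm (M.mulVec v)‖ ^ 2 := by
    rw [EuclideanSpace.norm_sq_eq, Finset.sum_mul]
    refine le_trans (Finset.sum_le_sum fun x hx => ?_)
      (Finset.sum_le_sum_of_subset_of_nonneg (Finset.subset_univ P) fun _ _ _ => by positivity)
    change _ ≤ ‖M.mulVec v x‖ ^ 2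
    rw [hMv x hx, norm_neg, norm_mul, mul_pow, Complex.norm_real, Real.norm_eq_abs, sq_abs]
  have h3 : a * b ^ 2 ≤ ε ^ 2 * b := by
    rw [← hvn] at h2 ⊢
    calc _ ≤ (ε * ‖v‖) ^ 2 := h2.trans (by gcongr)
      _ = _ := by ring
  rcases hb0.eq_or_lt with h | h
  · rw [← h, mul_zero]; positivity
  · refine le_of_mul_le_mul_right ?_ h
    linarith [h3, (by ring : a * b * b = a * b ^ 2)]

lemma hammingNorm_sub_le (x y : Bits n) :
    (hammingNorm x : ℝ) - hammingNorm y ≤ hammingDist x y := by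
  have := hammingDist_triangle x y 0
  rw [hammingDist_zero_right, hammingDist_zero_right] at this
  have : (hammingNorm x : ℝ) ≤ hammingDist x y + hammingNorm y := by exact_mod_cast this
  linarith

/-- The Hamming weight of a pure state close to a `k`-local operator concentrates around its
median. -/
lemma weightPr_deviation_le {φ : Bits n → ℂ} {k : ℕ} {K : Op n} (hK : K ∈ kLocal n k)
    {ε : ℝ} (hKρ : ‖K - Matrix.vecMulVec φ (star φ)‖ ≤ ε) {m : ℝ}
    (hm : IsWeightMedian (Matrix.vecMulVec φ (star φ)) m) {D : ℝ} (hD : (k : ℝ) ≤ D) :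
    weightPr (Matrix.vecMulVec φ (star φ)) {w | D < |w - m|} ≤ 4 * ε ^ 2 := by
  classical
  obtain ⟨hm1, hm2⟩ := hm
  rw [weightPr_vecMulVec] at hm1 hm2 ⊢
  have key : ∀ p b e : ℝ, 1 / 2 ≤ p → 0 ≤ b → p * b ≤ e → b ≤ 2 * e := fun p b e hp hb h => by
    nlinarith
  have h1 := key _ _ _ hm1 (Finset.sum_nonneg fun _ _ => by positivity)
    (sum_mul_sum_le_of_kLocal_approx hK hKρ
      (Q := Finset.univ.filter fun x : Bits n => m + D < (hammingNorm x : ℝ)) fun x hx y hy => by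
        have hx' : (hammingNorm x : ℝ) ≤ m := (Finset.mem_filter.1 hx).2
        have hy' := (Finset.mem_filter.1 hy).2
        have h := hammingNorm_sub_le y x
        rw [hammingDist_comm] at h
        exact_mod_cast (by linarith : (k : ℝ) < hammingDist x y))
  have h2 := key _ _ _ hm2 (Finset.sum_nonneg fun _ _ => by positivity)
    (sum_mul_sum_le_of_kLocal_approx hK hKρ
      (Q := Finset.univ.filter fun x : Bits n => (hammingNorm x : ℝ) < m - D) fun x hx y hy => by
        have hx' : m ≤ (hammingNorm x : ℝ) := (Finset.mem_filter.1 hx).2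
        have hy' := (Finset.mem_filter.1 hy).2
        have h := hammingNorm_sub_le x y
        exact_mod_cast (by linarith : (k : ℝ) < hammingDist x y))
  have h3 : Finset.univ.filter (fun x : Bits n => (hammingNorm x : ℝ) ∈ {w : ℝ | D < |w - m|}) ⊆
      Finset.univ.filter (fun x : Bits n => m + D < (hammingNorm x : ℝ)) ∪
        Finset.univ.filter (fun x : Bits n => (hammingNorm x : ℝ) < m - D) := by
    intro x hx
    have hx' : D < |(hammingNorm x : ℝ) - m| := (Finset.mem_filter.1 hx).2
    rw [Finset.mem_union, Finset.mem_filter, Finset.mem_filter]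
    rcases lt_abs.1 hx' with h | h
    · exact Or.inl ⟨Finset.mem_univ _, by linarith⟩
    · exact Or.inr ⟨Finset.mem_univ _, by linarith⟩
  have h4 := (Finset.sum_le_sum_of_subset_of_nonneg h3
    fun x _ _ => by positivity : _ ≤ ∑ x ∈ _, ‖φ x‖ ^ 2)
  have h5 := Finset.sum_union_inter (s₁ := Finset.univ.filter fun x : Bits n =>
    m + D < (hammingNorm x : ℝ)) (s₂ := Finset.univ.filter fun x : Bits n =>
    (hammingNorm x : ℝ) < m - D) (f := fun x => ‖φ x‖ ^ 2)
  have h6 : 0 ≤ ∑ x ∈ Finset.univ.filter (fun x : Bits n => m + D < (hammingNorm x : ℝ)) ∩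
      Finset.univ.filter (fun x : Bits n => (hammingNorm x : ℝ) < m - D), ‖φ x‖ ^ 2 :=
    Finset.sum_nonneg fun _ _ => by positivity
  linarith

/-- The evolution of a pure product state stays pure. -/
lemma exists_outputState_eq_vecMulVec {ρ₀ : Op n} (hρ : IsPureProductState ρ₀) (p : ℕ)
    (H : Fin p → CommutingHamiltonian n ℓ) :
    ∃ φ : Bits n → ℂ, outputState ρ₀ p H = Matrix.vecMulVec φ (star φ) := by
  induction p with
  | zero =>
    obtain ⟨ψ, -, hρ⟩ := hρ
    refine ⟨fun x => ∏ i, ψ i (x i), ?_⟩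
    ext x y
    exact hρ x y
  | succ p ih =>
    obtain ⟨φ, hφ⟩ := ih fun i => H i.castSucc
    refine ⟨(H (Fin.last p)).unitary.mulVec φ, ?_⟩
    rw [outputState, hφ, Matrix.mul_vecMulVec, Matrix.vecMulVec_mul, Matrix.star_mulVec]

end Concentration

/-! ### Growth of the locality along the evolution -/

section Growth

open scoped Matrix.Norms.L2Operator

/-- A bound on the locality needed to approximate the state after `q` layers, where `b` stands for a
multiple of `log n`. -/
noncomputable def localityBound (b α : ℝ) (n q : ℕ) : ℝ :=
  b ^ (q + 1) * (n : ℝ) ^ (1 - (1 - α) ^ q * (3 / 8))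

/-- The exponent `1 - (1 - α) ^ q * (3 / 8)` is multiplied by `1 - α` and increased by `α` in each
layer. -/
lemma mul_rpow_localityBound_le {b α : ℝ} (hb : 1 ≤ b) (hα₀ : 0 ≤ α) {n : ℕ} (hn : 0 < n)
    (q : ℕ) :
    b * ((n : ℝ) ^ α * localityBound b α n q ^ (1 - α)) ≤ localityBound b α n (q + 1) := by
  have hn' : (0 : ℝ) < n := by exact_mod_cast hn
  have hb0 : 0 ≤ b := by linarith
  have h1 : (b ^ (q + 1)) ^ (1 - α) ≤ b ^ (q + 1) := by
    conv_rhs => rw [← Real.rpow_one (b ^ (q + 1))]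
    exact Real.rpow_le_rpow_of_exponent_le (one_le_pow₀ hb) (by linarith)
  rw [localityBound, localityBound, Real.mul_rpow (by positivity) (by positivity),
    ← Real.rpow_mul hn'.le]
  calc _ = b * (b ^ (q + 1)) ^ (1 - α) *
        ((n : ℝ) ^ α * (n : ℝ) ^ ((1 - (1 - α) ^ q * (3 / 8)) * (1 - α))) := by ring
    _ ≤ b * b ^ (q + 1) *
        ((n : ℝ) ^ α * (n : ℝ) ^ ((1 - (1 - α) ^ q * (3 / 8)) * (1 - α))) := by gcongr
    _ = _ := by
        rw [← Real.rpow_add hn']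
        congr 1
        · ring
        · congr 1; ring

/-- The powers of `b` are absorbed in the gap between the exponents `3 / 8` and `1 / 4`. -/
lemma localityBound_le {b α : ℝ} (hb : 1 ≤ b) (hα₀ : 0 ≤ α) (hα₁ : α ≤ 1) {n p q : ℕ}
    (hn : 0 < n) (hqp : q ≤ p) (hbp : b ^ (p + 1) ≤ (n : ℝ) ^ ((1 - α) ^ p / 8)) :
    localityBound b α n q ≤ (n : ℝ) ^ (1 - (1 - α) ^ q / 4) := by
  have hn' : (1 : ℝ) ≤ n := by exact_mod_cast hn
  have h1 : b ^ (q + 1) ≤ (n : ℝ) ^ ((1 - α) ^ q / 8) := by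
    refine (pow_le_pow_right₀ hb (by omega)).trans (hbp.trans ?_)
    refine Real.rpow_le_rpow_of_exponent_le hn' ?_
    have := pow_le_pow_of_le_one (sub_nonneg.2 hα₁) (by linarith) hqp
    linarith
  calc localityBound b α n q
      ≤ (n : ℝ) ^ ((1 - α) ^ q / 8) * (n : ℝ) ^ (1 - (1 - α) ^ q * (3 / 8)) := by
        rw [localityBound]; gcongr
    _ = _ := by rw [← Real.rpow_add (by linarith)]; congr 1; ring

lemma rpow_le_localityBound {b α : ℝ} (hb : 1 ≤ b) (hα₀ : 0 ≤ α) (hα₁ : α ≤ 1) {n : ℕ}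
    (hn : 0 < n) (q : ℕ) : (n : ℝ) ^ (1 / 8 : ℝ) ≤ localityBound b α n q := by
  have hn' : (1 : ℝ) ≤ n := by exact_mod_cast hn
  have h1 : (1 - α) ^ q ≤ 1 := pow_le_one₀ (by linarith) (by linarith)
  calc (n : ℝ) ^ (1 / 8 : ℝ) = 1 * (n : ℝ) ^ (1 / 8 : ℝ) := (one_mul _).symm
    _ ≤ b ^ (q + 1) * (n : ℝ) ^ (1 - (1 - α) ^ q * (3 / 8)) := by
        have h2 : (1 / 8 : ℝ) ≤ 1 - (1 - α) ^ q * (3 / 8) := by linarith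
        gcongr
        exact one_le_pow₀ hb

/-- A Taylor degree for one layer: it makes the error on operators on `k` qubits at most
`exp (-4 - 2 n ^ (1 / 8)) n ^ (-k)`, where `L = log n`, and the new locality at most a multiple of
`L n ^ α κ ^ (1 - α)`. As `κ ≤ n`, this dominates `κ`, hence also `n ^ (1 / 8)`. -/
lemma exists_degree {α C L κ : ℝ} (hα₀ : 0 ≤ α) (hα₁ : α ≤ 1) (hC : 0 ≤ C) (hL : 1 ≤ L) {n : ℕ}
    (hn : 0 < n) (hκ₁ : (n : ℝ) ^ (1 / 8 : ℝ) ≤ κ) (hκ₂ : κ ≤ n) (ℓ : ℕ) {k : ℕ}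
    (hk : (k : ℝ) ≤ κ) :
    ∃ d : ℕ, Real.exp 1 * (C * (n : ℝ) ^ α * (k : ℝ) ^ (1 - α)) - d ≤
        -(4 + 2 * (n : ℝ) ^ (1 / 8 : ℝ) + k * L) ∧
      ((k + 2 * (d * ℓ) : ℕ) : ℝ) ≤
        (5 + 2 * ℓ * (3 * C + 8)) * L * ((n : ℝ) ^ α * κ ^ (1 - α)) := by
  have hn' : (1 : ℝ) ≤ n := by exact_mod_cast hn
  have hκ0 : 1 ≤ κ := (Real.one_le_rpow hn' (by norm_num)).trans hκ₁
  set s : ℝ := (n : ℝ) ^ (1 / 8 : ℝ) with hs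
  set Y : ℝ := (n : ℝ) ^ α * κ ^ (1 - α) with hY
  have hκY : κ ≤ Y := by
    calc κ = κ ^ α * κ ^ (1 - α) := by
          rw [← Real.rpow_add (by linarith), add_sub_cancel, Real.rpow_one]
      _ ≤ Y := by rw [hY]; gcongr
  have hkY : (n : ℝ) ^ α * (k : ℝ) ^ (1 - α) ≤ Y := by
    have : 0 ≤ 1 - α := by linarith
    rw [hY]; gcongr
  have hnum : 0 ≤ 3 * (C * Y) + 4 + 2 * s + κ * L := by positivity
  refine ⟨⌈3 * (C * Y) + 4 + 2 * s + κ * L⌉₊, ?_, ?_⟩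
  · have h1 := Nat.le_ceil (3 * (C * Y) + 4 + 2 * s + κ * L)
    have h2 : Real.exp 1 * (C * (n : ℝ) ^ α * (k : ℝ) ^ (1 - α)) ≤ 3 * (C * Y) := by
      rw [mul_assoc C]
      have := Real.exp_one_lt_three.le
      gcongr
    have h3 : k * L ≤ κ * L := by gcongr
    linarith
  · have h1 := (Nat.ceil_lt_add_one hnum).le
    set d := ⌈3 * (C * Y) + 4 + 2 * s + κ * L⌉₊
    have h2 : (d : ℝ) ≤ (3 * C + 8) * (L * Y) := by
      have h3 : C * Y ≤ C * (L * Y) := mul_le_mul_of_nonneg_left (by nlinarith) hC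
      have h4 : κ * L ≤ L * Y := by nlinarith
      have h5 : Y ≤ L * Y := by nlinarith
      nlinarith
    have h6 : (d : ℝ) * ℓ ≤ (3 * C + 8) * (L * Y) * ℓ := by gcongr
    have h7 : Y ≤ L * Y := by nlinarith
    push_cast
    nlinarith

variable {n ℓ : ℕ}

lemma norm_outputState_le_one {ρ₀ : Op n} (hρ : IsPureProductState ρ₀) (p : ℕ)
    (H : Fin p → CommutingHamiltonian n ℓ) : ‖outputState ρ₀ p H‖ ≤ 1 := by
  induction p with
  | zero => exact hρ.norm_le_one
  | succ p ih =>
    exact (norm_conj_le (Unitary.star_mul_self_of_mem (H (Fin.last p)).unitary_mem_unitary) _).trans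
      (ih _)

/-- After `q` layers the state is close to an operator whose locality is bounded by `localityBound`;
every layer, like the approximation of the initial state, adds the same error. -/
lemma exists_kLocal_approx_outputState {α C : ℝ} (hα₀ : 0 ≤ α) (hα₁ : α ≤ 1) (hC : 0 ≤ C)
    (hn : 0 < n) (hL : 1 ≤ Real.log n) {p : ℕ}
    (hp : (p + 1 : ℝ) ≤ Real.exp ((n : ℝ) ^ (1 / 8 : ℝ)))
    (hbp : ((5 + 2 * ℓ * (3 * C + 8)) * Real.log n) ^ (p + 1) ≤ (n : ℝ) ^ ((1 - α) ^ p / 8))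
    {ρ₀ : Op n} (hρ : IsPureProductState ρ₀) {q : ℕ} (hqp : q ≤ p)
    (H : Fin q → CommutingHamiltonian n ℓ) (hH : ∀ i, (H i).SubsetNormBound α C) :
    ∃ k : ℕ, (k : ℝ) ≤ localityBound ((5 + 2 * ℓ * (3 * C + 8)) * Real.log n) α n q ∧
      ∃ K ∈ kLocal n k, ‖K - outputState ρ₀ q H‖ ≤
        (q + 1) * Real.exp (-(2 * (n : ℝ) ^ (1 / 8 : ℝ))) := by
  have hn' : (1 : ℝ) ≤ n := by exact_mod_cast hn
  set s : ℝ := (n : ℝ) ^ (1 / 8 : ℝ) with hs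
  have hs1 : 1 ≤ s := Real.one_le_rpow hn' (by norm_num)
  set L := Real.log n with hLdef
  have hB5 : 5 ≤ 5 + 2 * ℓ * (3 * C + 8) := by
    have : 0 ≤ 2 * ℓ * (3 * C + 8) := by positivity
    linarith
  set b := (5 + 2 * ℓ * (3 * C + 8)) * L with hb
  have hb5 : 5 ≤ b := by nlinarith
  have hb1 : 1 ≤ b := by linarith
  induction q with
  | zero =>
    set d := ⌈4 * (n : ℝ) ^ (5 / 8 : ℝ)⌉₊ with hd
    refine ⟨d, ?_, ?_⟩
    · have h1 : (1 : ℝ) ≤ (n : ℝ) ^ (5 / 8 : ℝ) := Real.one_le_rpow hn' (by norm_num)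
      have h2 := (Nat.ceil_lt_add_one (by positivity : 0 ≤ 4 * (n : ℝ) ^ (5 / 8 : ℝ))).le
      rw [localityBound, zero_add, pow_one, pow_zero, show (1 : ℝ) - 1 * (3 / 8) = 5 / 8 by norm_num]
      nlinarith
    · obtain ⟨K, hK, hKρ⟩ := hρ.exists_kLocal_approx hn d
      refine ⟨K, hK, hKρ.trans ?_⟩
      have h1 : 4 * s ≤ d / Real.sqrt n := by
        rw [le_div_iff₀ (Real.sqrt_pos.2 (by linarith)), Real.sqrt_eq_rpow, mul_assoc, hs,
          ← Real.rpow_add (by linarith)]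
        norm_num
        exact Nat.le_ceil _
      have h2 : (2 : ℝ) ≤ Real.exp (2 * s) := by
        linarith [Real.add_one_le_exp (2 * s)]
      calc 2 * Real.exp (-(d / Real.sqrt n)) ≤ Real.exp (2 * s) * Real.exp (-(4 * s)) := by
            gcongr
        _ = Real.exp (-(2 * s)) := by rw [← Real.exp_add]; congr 1; ring
        _ = _ := by simp
  | succ q ih =>
    obtain ⟨k, hk, K, hK, hKρ⟩ := ih (by omega) (fun i => H i.castSucc) fun i => hH _
    have hκn : localityBound b α n q ≤ n := by
      refine (localityBound_le hb1 hα₀ hα₁ hn (by omega : q ≤ p) hbp).trans ?_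
      conv_rhs => rw [← Real.rpow_one (n : ℝ)]
      have : 0 ≤ (1 - α) ^ q := pow_nonneg (by linarith) _
      exact Real.rpow_le_rpow_of_exponent_le hn' (by linarith)
    obtain ⟨d, hd1, hd2⟩ := exists_degree hα₀ hα₁ hC hL hn
      (rpow_le_localityBound hb1 hα₀ hα₁ hn q) hκn ℓ hk
    have hd2' : ((k + 2 * (d * ℓ) : ℕ) : ℝ) ≤ localityBound b α n (q + 1) :=
      hd2.trans (mul_rpow_localityBound_le hb1 hα₀ hn q)
    set ρ := outputState ρ₀ q fun i => H i.castSucc with hρdef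
    set U := (H (Fin.last q)).unitary with hU
    have hUU : U.conjTranspose * U = 1 :=
      Unitary.star_mul_self_of_mem (H (Fin.last q)).unitary_mem_unitary
    have hρ1 : ‖ρ‖ ≤ 1 := norm_outputState_le_one hρ _ _
    obtain ⟨B, hB, hBn⟩ := (H (Fin.last q)).exists_kLocal_approx hα₁ hC (hH _) hn
      (Real.exp_le_exp.2 hd1) (Real.exp_le_one_iff.2 (by
        have : 0 ≤ k * L := by positivity
        linarith)) hK
    refine ⟨_, hd2', B, hB, ?_⟩
    have hq1 : (q + 1 : ℝ) * Real.exp (-(2 * s)) ≤ 1 := by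
      have h1 : (q : ℝ) + 1 ≤ p + 1 := by exact_mod_cast (by omega : q + 1 ≤ p + 1)
      calc _ ≤ Real.exp s * Real.exp (-(2 * s)) := by gcongr; exact h1.trans hp
        _ = Real.exp (-s) := by rw [← Real.exp_add]; congr 1; ring
        _ ≤ 1 := Real.exp_le_one_iff.2 (by linarith)
    have hK2 : ‖K‖ ≤ 2 := by
      calc ‖K‖ = ‖(K - ρ) + ρ‖ := by rw [sub_add_cancel]
        _ ≤ 1 + 1 := norm_add_le_of_le (hKρ.trans hq1) hρ1
        _ = 2 := by norm_num
    have h1 : ‖B - U * K * star U‖ ≤ Real.exp (-(2 * s)) := by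
      refine hBn.trans ?_
      -- The factor `n ^ k = exp (k log n)` cancels, and `6 ≤ exp 2`.
      have e1 : (n : ℝ) ^ k = Real.exp (k * L) := by
        rw [Real.exp_nat_mul, hLdef, Real.exp_log (by linarith)]
      have e2 : 6 ≤ Real.exp 2 := by
        have := Real.exp_one_gt_d9
        rw [show (2 : ℝ) = 1 + 1 by norm_num, Real.exp_add]
        nlinarith
      calc _ ≤ 3 * Real.exp (-(4 + 2 * s + k * L)) * (Real.exp 2 * (n : ℝ) ^ k) * 2 := by gcongr
        _ = 6 * (Real.exp (-(4 + 2 * s + k * L)) * (Real.exp 2 * Real.exp (k * L))) := by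
            rw [e1]; ring
        _ ≤ Real.exp 2 * (Real.exp (-(4 + 2 * s + k * L)) * (Real.exp 2 * Real.exp (k * L))) := by
            gcongr
        _ = Real.exp (-(2 * s)) := by
            rw [← Real.exp_add, ← Real.exp_add, ← Real.exp_add]; congr 1; ring
    have h2 : ‖U * K * star U - U * ρ * star U‖ ≤ (q + 1) * Real.exp (-(2 * s)) := by
      rw [← sub_mul, ← mul_sub]
      exact (norm_conj_le hUU _).trans hKρ
    calc ‖B - outputState ρ₀ (q + 1) H‖
        = ‖(B - U * K * star U) + (U * K * star U - U * ρ * star U)‖ := by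
          rw [sub_add_sub_cancel]; rfl
      _ ≤ Real.exp (-(2 * s)) + (q + 1) * Real.exp (-(2 * s)) := norm_add_le_of_le h1 h2
      _ = _ := by push_cast; ring

end Growth

/-! ### Asymptotics for `p = o(log log n)` -/

section Asymptotic

/-- For `p ≤ s / 2` and `(1 - α) ^ p ≥ exp (-s / 2)`, where `s = log log n`, a power `(B log n)^(p+1)`
is smaller than `n ^ ((1 - α) ^ p / 8)`: its logarithm is of order `s ^ 2`, against `exp (s / 2)`. -/
lemma pow_le_rpow_of_loglog {B α s : ℝ} {n p : ℕ} (hB : 0 < B) (hBs : Real.log B ≤ s)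
    (hs : 1536 ≤ s) (hn : 0 < n) (hlog : Real.log n = Real.exp s) (hp : (p : ℝ) ≤ s / 2)
    (hα : Real.exp (-(s / 2)) ≤ (1 - α) ^ p) :
    (B * Real.log n) ^ (p + 1) ≤ (n : ℝ) ^ ((1 - α) ^ p / 8) := by
  have hn' : (0 : ℝ) < n := by exact_mod_cast hn
  have h1 : B * Real.log n = Real.exp (Real.log B + s) := by
    rw [Real.exp_add, Real.exp_log hB, hlog]
  rw [h1, ← Real.exp_nat_mul, Real.rpow_def_of_pos hn', Real.exp_le_exp, hlog]
  have h2 : (s / 2) ^ 3 / (Nat.factorial 3 : ℝ) ≤ Real.exp (s / 2) :=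
    Real.pow_div_factorial_le_exp _ (by linarith) 3
  have h3 : Real.exp s * Real.exp (-(s / 2)) = Real.exp (s / 2) := by
    rw [← Real.exp_add]; congr 1; ring
  have h4 : Real.exp (s / 2) ≤ Real.exp s * (1 - α) ^ p := by
    rw [← h3]; gcongr
  have h5 : ((p + 1 : ℕ) : ℝ) * (Real.log B + s) ≤ s * (2 * s) := by
    push_cast
    have : (0 : ℝ) ≤ p := Nat.cast_nonneg p
    calc _ ≤ ((p : ℝ) + 1) * (2 * s) := by
          refine mul_le_mul_of_nonneg_left ?_ (by positivity)
          linarith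
      _ ≤ s * (2 * s) := by
          refine mul_le_mul_of_nonneg_right ?_ (by linarith)
          linarith
  have h6 : s * (2 * s) * 8 ≤ (s / 2) ^ 3 / (Nat.factorial 3 : ℝ) := by
    norm_num [Nat.factorial]
    nlinarith [mul_nonneg (sq_nonneg s) (sub_nonneg.2 hs)]
  linarith

lemma eventually_loglog {p : ℕ → ℕ} {α : ℝ} (hα₀ : 0 ≤ α) (hα₁ : α < 1)
    (hp : (fun n : ℕ => (p n : ℝ)) =o[atTop] fun n : ℕ => Real.log (Real.log (n : ℝ))) (s₀ : ℝ) :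
    ∀ᶠ n : ℕ in atTop, ∃ s : ℝ, s₀ ≤ s ∧ 0 < n ∧ Real.log n = Real.exp s ∧ (p n : ℝ) ≤ s / 2 ∧
      Real.exp (-(s / 2)) ≤ (1 - α) ^ p n := by
  have hα : 0 < 1 - α := by linarith
  set β : ℝ := -Real.log (1 - α) with hβ
  have hβ0 : 0 ≤ β := neg_nonneg.2 (Real.log_nonpos hα.le (by linarith))
  have ht : Tendsto (fun n : ℕ => Real.log (Real.log (n : ℝ))) atTop atTop :=
    Real.tendsto_log_atTop.comp (Real.tendsto_log_atTop.comp tendsto_natCast_atTop_atTop)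
  have ht' : Tendsto (fun n : ℕ => Real.log (n : ℝ)) atTop atTop :=
    Real.tendsto_log_atTop.comp tendsto_natCast_atTop_atTop
  filter_upwards [hp.bound (by positivity : 0 < 1 / (2 * (1 + β))), ht.eventually_ge_atTop s₀,
    ht.eventually_ge_atTop 0, ht'.eventually_gt_atTop 0, eventually_gt_atTop 0]
    with n h1 h2 h3 h4 h5
  set s := Real.log (Real.log (n : ℝ))
  rw [Real.norm_natCast, Real.norm_of_nonneg h3] at h1
  have h6 : (1 + β) * p n ≤ s / 2 := by
    calc (1 + β) * p n ≤ (1 + β) * (1 / (2 * (1 + β)) * s) := by gcongr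
      _ = s / 2 := by field_simp
  have h7 : 0 ≤ β * p n := by positivity
  refine ⟨s, h2, h5, (Real.exp_log h4).symm, by linarith, ?_⟩
  rw [← Real.rpow_natCast, Real.rpow_def_of_pos hα, Real.exp_le_exp,
    show Real.log (1 - α) = -β by rw [hβ, neg_neg]]
  have : (0 : ℝ) ≤ p n := Nat.cast_nonneg _
  linarith

/-- `n ^ (-(1 - α) ^ p / 4) ≤ exp (-exp (s / 2) / 4)` for `s = log log n`. -/
lemma deviation_one_isLittleO {p : ℕ → ℕ} {α : ℝ} (hα₀ : 0 ≤ α) (hα₁ : α < 1)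
    (hp : (fun n : ℕ => (p n : ℝ)) =o[atTop] fun n : ℕ => Real.log (Real.log (n : ℝ))) :
    (fun n : ℕ => deviation 1 α n (p n)) =o[atTop] fun n : ℕ => (n : ℝ) := by
  rw [isLittleO_iff]
  intro c hc
  filter_upwards [eventually_loglog hα₀ hα₁ hp (max 0 (8 / c))]
    with n ⟨s, hs, hn, hlog, _, hα⟩
  have hn' : (0 : ℝ) < n := by exact_mod_cast hn
  have hs0 : 0 ≤ s := (le_max_left _ _).trans hs
  have hsc : 8 / c ≤ s := (le_max_right _ _).trans hs
  rw [Real.norm_natCast, Real.norm_of_nonneg (by rw [deviation]; positivity), deviation, one_pow,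
    one_mul, sub_eq_add_neg, Real.rpow_add hn', Real.rpow_one, mul_comm]
  refine mul_le_mul_of_nonneg_right ?_ hn'.le
  rw [Real.rpow_def_of_pos hn', hlog]
  have h3 : Real.exp s * Real.exp (-(s / 2)) = Real.exp (s / 2) := by
    rw [← Real.exp_add]; congr 1; ring
  have h4 : Real.exp (s / 2) ≤ Real.exp s * (1 - α) ^ p n := by
    rw [← h3]; gcongr
  have h5 : s / 2 ≤ Real.exp (s / 2) := by linarith [Real.add_one_le_exp (s / 2)]
  have h6 : 1 / c ≤ s / 8 := by
    rw [div_le_iff₀ hc] at hsc ⊢; linarith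
  calc _ ≤ Real.exp (-(1 / c)) := Real.exp_le_exp.2 (by linarith)
    _ = (Real.exp (1 / c))⁻¹ := Real.exp_neg _
    _ ≤ (1 / c)⁻¹ := by
        gcongr
        linarith [Real.add_one_le_exp (1 / c)]
    _ = c := by simp

end Asymptotic
end DenseEvolution

open DenseEvolution in
theorem corollary4p4 (ℓ : ℕ) (α C : ℝ) (hα₀ : 0 ≤ α) (hα₁ : α < 1) (hC : 0 < C) :
    ∃ c₁ : ℝ, 0 < c₁ ∧
      ∀ p : ℕ → ℕ,
        (fun n : ℕ => (p n : ℝ)) =o[atTop] (fun n : ℕ => Real.log (Real.log (n : ℝ))) →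
        (fun n : ℕ => DenseEvolution.deviation c₁ α n (p n)) =o[atTop] (fun n : ℕ => (n : ℝ)) ∧
        ∀ᶠ n : ℕ in atTop,
          ∀ (ρ₀ : DenseEvolution.Op n) (H : Fin (p n) → DenseEvolution.CommutingHamiltonian n ℓ),
            DenseEvolution.IsPureProductState ρ₀ →
            (∀ i, (H i).SubsetNormBound α C) →
            ∀ m : ℝ, DenseEvolution.IsWeightMedian (DenseEvolution.outputState ρ₀ (p n) H) m →
              DenseEvolution.weightPr (DenseEvolution.outputState ρ₀ (p n) H)
                  {w : ℝ | DenseEvolution.deviation c₁ α n (p n) < |w - m|} ≤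
                128 * Real.exp (-(Real.sqrt 2 * (n : ℝ) ^ ((1 : ℝ) / 8))) := by
  -- `c₁ = 1` suffices: degree about `n ^ (5 / 8)`, not `n ^ (3 / 4)`, is enough to approximate the
  -- initial state, and this gap absorbs all factors `(B log n) ^ (p + 1)`.
  refine ⟨1, one_pos, fun p hp => ⟨deviation_one_isLittleO hα₀ hα₁ hp, ?_⟩⟩
  set B : ℝ := 5 + 2 * ℓ * (3 * C + 8) with hB
  have hB0 : 5 ≤ B := by
    have : 0 ≤ 2 * ℓ * (3 * C + 8) := by positivity
    linarith
  filter_upwards [eventually_loglog hα₀ hα₁ hp (max 1536 (Real.log B))]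
    with n ⟨s, hs, hn, hlog, hps, hα⟩ ρ₀ H hρ hH m hm
  have hs1 : 1536 ≤ s := (le_max_left _ _).trans hs
  have hn' : (0 : ℝ) < n := by exact_mod_cast hn
  set t : ℝ := (n : ℝ) ^ ((1 : ℝ) / 8) with ht
  have ht0 : 0 ≤ t := by positivity
  have hL : 1 ≤ Real.log n := by
    rw [hlog]; exact Real.one_le_exp (by linarith)
  have hbp := pow_le_rpow_of_loglog (by linarith : 0 < B) ((le_max_right _ _).trans hs) hs1 hn hlog
    hps hα
  have hpt : (p n + 1 : ℝ) ≤ Real.exp t := by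
    refine (Real.add_one_le_exp _).trans (Real.exp_le_exp.2 ?_)
    have h1 : s ^ 2 / (Nat.factorial 2 : ℝ) ≤ Real.exp s :=
      Real.pow_div_factorial_le_exp _ (by linarith) 2
    have h2 : Real.log n / 8 ≤ t := by
      rw [ht, Real.rpow_def_of_pos hn']
      linarith [Real.add_one_le_exp (Real.log n * (1 / 8))]
    norm_num [Nat.factorial] at h1
    rw [hlog] at h2
    nlinarith
  obtain ⟨k, hk, K, hK, hKρ⟩ := exists_kLocal_approx_outputState hα₀ hα₁.le hC.le hn hL hpt hbp hρ
    le_rfl H hH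
  obtain ⟨φ, hφ⟩ := exists_outputState_eq_vecMulVec hρ (p n) H
  rw [hφ] at hm hKρ ⊢
  have hkD : (k : ℝ) ≤ deviation 1 α n (p n) := by
    rw [deviation, one_pow, one_mul]
    exact hk.trans (localityBound_le (by nlinarith) hα₀ hα₁.le hn le_rfl hbp)
  have hε : (p n + 1) * Real.exp (-(2 * t)) ≤ Real.exp (-t) := by
    calc _ ≤ Real.exp t * Real.exp (-(2 * t)) := by gcongr
      _ = Real.exp (-t) := by rw [← Real.exp_add]; congr 1; ring
  refine (weightPr_deviation_le hK (hKρ.trans hε) hm hkD).trans ?_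
  have h2 : Real.sqrt 2 ≤ 2 := by
    rw [Real.sqrt_le_left (by norm_num)]; norm_num
  calc 4 * Real.exp (-t) ^ 2 = 4 * Real.exp (-(2 * t)) := by
        rw [← Real.exp_nat_mul]; congr 2; push_cast; ring
    _ ≤ 128 * Real.exp (-(Real.sqrt 2 * t)) := by gcongr; norm_num
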